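/- Let $\mathbb K\in\{\mathbb R,\mathbb C\}$, let $A:\mathbb K\to\mathbb C^{m\times m}$ be continuous with a full asymptotic expansion $A(\rho)\sim A_0+\rho A_1+\rho^2A_2+\cdots$ as $\rho\to0$ (that is, $A(\rho)-\sum_{k\le N}\rho^kA_k=\mathcal O(\rho^{N+1})$ for all $N$). **Multi-step scheme.** A run of the scheme up to level $n$ consists of the following. Put $\tilde\Lambda_0=A_0$, and let $\Pi_{-1}$ be the trivial partition of $\{1,\dots,m\}$ (one class). * For each $k=0,\dots,n$ the matrix $\tilde\Lambda_k$ is diagonable, and $\tilde M_k$ is an invertible, $\Pi_{k-1}$-block-diagonal matrix with $\tilde M_k^{-1}\tilde\Lambda_k\tilde M_k=\Lambda_k=\operatorname{diag}(\lambda^{[k]}_1,\dots,\lambda^{[k]}_m)$. The partition $\Pi_k$ is given by $i\sim_{\Pi_k}j\iff\lambda^{[k']}_i=\lambda^{[k']}_j$ for all $k'\le k$, and $\tilde M_k$ is chosen such that the classes of $\Pi_k$ consist of consecutive indices. * $\tilde A^{[0]}(\rho)=\tilde M_0^{-1}A(\rho)\tilde M_0$. * For $0\le k<n$, let $\tilde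 A^{[k]}_{k+1}$ be the coefficient of $\rho^{k+1}$ in the asymptotic expansion of $\tilde A^{[k]}(\rho)$ and set $A^{[k,-1]}_{k+1}=\tilde A^{[k]}_{k+1}$. For $\ell=0,\dots,k$ let $A^{[k,\ell]}_{k+1}$ be the $\Pi_\ell$-block-diagonal part of $A^{[k,\ell-1]}_{k+1}$, and let $K^{[k]}_\ell$ be a $\Pi_{\ell-1}$-block-diagonal solution of $[\Lambda_\ell,K^{[k]}_\ell]+A^{[k,\ell-1]}_{k+1}-A^{[k,\ell]}_{k+1}=0$. Then $\tilde\Lambda_{k+1}=A^{[k,k]}_{k+1}$ and $\tilde A^{[k+1]}(\rho)=T_k(\rho)^{-1}\tilde A^{[k]}(\rho)T_k(\rho)$ with $T_k(\rho)=(I+\rho^{k+1}K^{[k]}_0)(I+\rho^{k}K^{[k]}_1)\cdots(I+\rho K^{[k]}_k)\tilde M_{k+1}$. The family $A(\rho)$ is *non-degenerate of order $n$ in $\rho=0$* if $n$ is the smallest number for which there is a run up to level $n$ such that each diagonal block of $\tilde\Lambda_n$ with respect to $\Pi_{n-1}$ is non-degenerate, i.e. has as many distinct eigenvalues as its size. **Theorem.**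 Assume that $A(\rho)$ is non-degenerate of order $n$ in $\rho=0$. Then there exist a uniformly bounded family of invertible matrices $M(\rho)$ with uniformly bounded inverse and with a full asymptotic expansion as $\rho\to0$, and diagonal matrices $\Lambda(\rho)$, such that $$A(\rho)M(\rho)-M(\rho)\Lambda(\rho)=\mathcal O(\rho^N)\quad(\rho\to0)\qquad\text{for all }N.$$ Furthermore, if $n\ge1$ or $m\ge2$, at least two eigenvalues of $A(\rho)$ coincide modulo $\mathcal O(\rho^n)$: there are functions $\lambda_1,\dots,\lambda_m:\mathbb K\to\mathbb C$, continuous in a neighbourhood of $0$, such that $\lambda_1(\rho),\dots,\lambda_m(\rho)$ are the eigenvalues of $A(\rho)$ counted with algebraic multiplicity for every $\rho$, and there are indices $i\ne j$ with $\lambda_i(\rho)-\lambda_j(\rho)=\mathcal O(\rho^n)$ as $\rho\to0$. -/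

import Mathlib

open Filter Topology Asymptotics
open scoped Matrix.Norms.Operator

namespace MultiStep

/-- Complex `m × m` matrices (normed, where a norm is used, by an operator norm). -/
abbrev Mat (m : ℕ) : Type := Matrix (Fin m) (Fin m) ℂ

/-- `F ρ ∼ a 0 + ρ a 1 + ρ² a 2 + ⋯` as `ρ → 0`. -/
def HasFullExpansion {𝕜 : Type*} [RCLike 𝕜] [NormedAlgebra 𝕜 ℂ] {m : ℕ}
    (F : 𝕜 → Mat m) (a : ℕ → Mat m) : Prop :=
  ∀ N : ℕ, (fun ρ : 𝕜 => F ρ - ∑ k ∈ Finset.range (N + 1), ρ ^ k • a k)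
    =O[𝓝 0] (fun ρ : 𝕜 => ρ ^ (N + 1))

/-- A square matrix of size `d` is non-degenerate if it has `d` distinct eigenvalues. -/
def NonDegenerate {ι : Type*} [Fintype ι] [DecidableEq ι] (B : Matrix ι ι ℂ) : Prop :=
  (spectrum ℂ B).ncard = Fintype.card ι

/-- The relation `∼` belonging to the partition `Π_{k-1}`: the diagonal entries of
`Λ_0, …, Λ_{k-1}` at the positions `i` and `j` agree. For `k = 0` this is the trivial
partition with a single class. -/
def SameBlock {m : ℕ} (lam : ℕ → Fin m → ℂ) (k : ℕ) (i j : Fin m) : Prop :=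
  ∀ k' < k, lam k' i = lam k' j

open Classical in
/-- `bdiag`: keep the entries inside the diagonal blocks, replace the others by `0`. -/
noncomputable def bdiag {m : ℕ} (r : Fin m → Fin m → Prop) (B : Mat m) : Mat m :=
  Matrix.of fun i j => if r i j then B i j else 0

/-- All entries outside the diagonal blocks vanish. -/
def IsBlockDiagonal {m : ℕ} (r : Fin m → Fin m → Prop) (B : Mat m) : Prop :=
  ∀ i j, ¬ r i j → B i j = 0

/-- Each class of the relation consists of consecutive indices. -/
def IsGrouped {m : ℕ} (r : Fin m → Fin m → Prop) : Prop :=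
  ∀ i j l, i ≤ j → j ≤ l → r i l → r i j

/-- The successive block-diagonal parts of the leading remainder `B = Ã^{[k]}_{k+1}`:
`subBlock lam B 0 = B` and `subBlock lam B (ℓ + 1) = A^{[k,ℓ]}_{k+1}`, the
`Π_ℓ`-block-diagonal part of `A^{[k,ℓ-1]}_{k+1}`. -/
noncomputable def subBlock {m : ℕ} (lam : ℕ → Fin m → ℂ) (B : Mat m) : ℕ → Mat m
  | 0 => B
  | ℓ + 1 => bdiag (SameBlock lam (ℓ + 1)) (subBlock lam B ℓ)

/-- The matrices `Λ̃_k` which have to be diagonalised: `Λ̃_0 = A_0`, `Λ̃_{k+1} = A^{[k,k]}_{k+1}`.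
Here `a` are the coefficients of the original family, `coef k` those of `Ã^{[k]}`. -/
noncomputable def tildeLambda {m : ℕ} (a : ℕ → Mat m) (lam : ℕ → Fin m → ℂ)
    (coef : ℕ → ℕ → Mat m) : ℕ → Mat m
  | 0 => a 0
  | k + 1 => subBlock lam (coef k (k + 1)) (k + 1)

/-- The transformation leading from level `k` to level `k + 1`:
`(I + ρ^{k+1} K_0)(I + ρ^k K_1) ⋯ (I + ρ K_k) M`. -/
noncomputable def stepTransform {𝕜 : Type*} [RCLike 𝕜] [NormedAlgebra 𝕜 ℂ] {m : ℕ}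
    (k : ℕ) (K : ℕ → Mat m) (M : Mat m) (ρ : 𝕜) : Mat m :=
  ((List.range (k + 1)).map fun ℓ => 1 + ρ ^ (k + 1 - ℓ) • K ℓ).prod * M

/-- A run of the multi-step diagonalisation scheme for the family `A` with expansion
coefficients `a`, in which `Λ̃_0, …, Λ̃_n` have all been diagonalised. Only the values of the data
at levels `≤ n` matter. -/
structure SchemeRun {𝕜 : Type*} [RCLike 𝕜] [NormedAlgebra 𝕜 ℂ] {m : ℕ}
    (A : 𝕜 → Mat m) (a : ℕ → Mat m) (n : ℕ) where
  /-- the transformed families `Ã^{[k]}` -/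
  fam : ℕ → 𝕜 → Mat m
  /-- `coef k j` is the coefficient of `ρ ^ j` in the expansion of `Ã^{[k]}` -/
  coef : ℕ → ℕ → Mat m
  /-- the diagonal entries of `Λ_k` -/
  lam : ℕ → Fin m → ℂ
  /-- `K k ℓ` is the matrix used in sub-step `ℓ` of the step from level `k` to level `k + 1` -/
  K : ℕ → ℕ → Mat m
  /-- the diagonalisers: `M 0` of `A_0`, `M k` of `Λ̃_k` -/
  M : ℕ → Mat m
  M_isUnit : ∀ k ≤ n, IsUnit (M k)
  M_block : ∀ k ≤ n, IsBlockDiagonal (SameBlock lam k) (M k)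
  M_diag : ∀ k ≤ n,
    (M k)⁻¹ * tildeLambda a lam coef k * M k = Matrix.diagonal (lam k)
  grouped : ∀ k ≤ n, IsGrouped (SameBlock lam (k + 1))
  K_block : ∀ k < n, ∀ ℓ ≤ k, IsBlockDiagonal (SameBlock lam ℓ) (K k ℓ)
  K_sylvester : ∀ k < n, ∀ ℓ ≤ k,
    (Matrix.diagonal (lam ℓ) * K k ℓ - K k ℓ * Matrix.diagonal (lam ℓ))
      + subBlock lam (coef k (k + 1)) ℓ - subBlock lam (coef k (k + 1)) (ℓ + 1) = 0
  fam_zero : ∀ ρ, fam 0 ρ = (M 0)⁻¹ * A ρ * M 0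
  fam_succ : ∀ k < n, ∀ ρ, fam (k + 1) ρ =
    (stepTransform k (K k) (M (k + 1)) ρ)⁻¹ * fam k ρ * stepTransform k (K k) (M (k + 1)) ρ
  fam_expansion : ∀ k ≤ n, HasFullExpansion (fam k) (coef k)

open Classical in
/-- The scheme can be run with diagonable `Λ̃_0, …, Λ̃_n`, and each of the diagonal blocks of `Λ̃_n`
(along the partition `Π_{n-1}`) is non-degenerate. -/
def HasNonDegenerateBlocks {𝕜 : Type*} [RCLike 𝕜] [NormedAlgebra 𝕜 ℂ] {m : ℕ}
    (A : 𝕜 → Mat m) (a : ℕ → Mat m) (n : ℕ) : Prop :=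
  ∃ S : SchemeRun A a n, ∀ i : Fin m,
    NonDegenerate
      (Matrix.of fun p q : {j : Fin m // SameBlock S.lam n i j} =>
        tildeLambda a S.lam S.coef n p.1 q.1)

/-- `A` is non-degenerate of order `n` in `ρ = 0`: `n` is the minimal number with the previous
property. -/
def NonDegenerateOfOrder {𝕜 : Type*} [RCLike 𝕜] [NormedAlgebra 𝕜 ℂ] {m : ℕ}
    (A : 𝕜 → Mat m) (a : ℕ → Mat m) (n : ℕ) : Prop :=
  IsLeast {k : ℕ | HasNonDegenerateBlocks A a k} n

end MultiStep

/-!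
The transformations of a run of the scheme are translated into formal power series with matrix
coefficients: expansions multiply like series and are unique, so the relation between consecutive
families becomes an identity `T_k * Ã^{[k+1]} = Ã^{[k]} * T_k` of series. Comparing coefficients one
factor of `T_k` at a time shows that the coefficients of order at most `k` of `Ã^{[k]}` are
`Λ_0, …, Λ_k` (`SchemeRun.coeff_series`).

Non-degeneracy of the blocks of `Λ̃_n` means that `Λ_0, …, Λ_n` together separate the indices, and
minimality of `n` means that `Λ_0, …, Λ_{n-1}` do not (`NonDegenerateOfOrder.exists_run`). Hence the
diagonal entries of the series of `Ã^{[n]}` differ by series of order at most `n`, whereas its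
off-diagonal entries are divisible by `X ^ (n + 1)`. The eigenvector equation can then be divided by
these differences and becomes a fixed point equation for an `X`-adic contraction
(`exists_formal_eigenvector`), which completes the diagonalisation formally to all orders in one
stroke. Borel summation of the formal diagonaliser gives `M` and `Λ`
(`exists_asymptotic_diagonaliser`).

For the eigenvalues, `μ i ρ = ∑_{k ≤ n} ρ ^ k λ^{[k]}_i` are continuous with mutual distances at
least `c ‖ρ‖ ^ n`. The diagonal entries of `Λ` differ from them by `O(ρ ^ (n + 1))`, and at these
entries the characteristic polynomial of `A` is `O(ρ ^ N)` for every `N`. Since that polynomial is the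
product of the distances to the `m` eigenvalues, an error of order `m (n + 1)` forces an eigenvalue
within `O(ρ ^ (n + 1))` of each `μ i`; the discs around the `μ i` are disjoint, so each contains
exactly one (`exists_eigenvalues_near`). The same product argument gives continuity. Two indices
that `Λ_0, …, Λ_{n-1}` fail to separate yield eigenvalues which agree modulo `O(ρ ^ n)`.
-/

namespace MultiStep

open scoped PowerSeries

/-! ### Asymptotic expansions and formal power series -/

section Powers

variable {𝕜 : Type*} [RCLike 𝕜]

theorem isBigO_pow_of_le {N k : ℕ} (h : k ≤ N) :
    (fun ρ : 𝕜 => ρ ^ N) =O[𝓝 0] (fun ρ : 𝕜 => ρ ^ k) := by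
  obtain ⟨d, rfl⟩ := Nat.exists_eq_add_of_le h
  have h1 : (fun ρ : 𝕜 => ρ ^ d) =O[𝓝 0] (fun _ => (1 : 𝕜)) :=
    ((continuous_pow d).tendsto 0).isBigO_one 𝕜
  simpa [pow_add] using (isBigO_refl (fun ρ : 𝕜 => ρ ^ k) (𝓝 0)).mul h1

theorem isBigO_pow_smul {E : Type*} [NormedAddCommGroup E] [NormedSpace 𝕜 E] (k : ℕ) (b : E) :
    (fun ρ : 𝕜 => ρ ^ k • b) =O[𝓝 0] (fun ρ : 𝕜 => ρ ^ k) := by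
  refine IsBigO.of_bound ‖b‖ (Eventually.of_forall fun ρ => ?_)
  rw [norm_smul, mul_comm]

theorem eq_zero_of_pow_smul_isBigO {E : Type*} [NormedAddCommGroup E] [NormedSpace 𝕜 E]
    {N : ℕ} {c : E}
    (h : (fun ρ : 𝕜 => ρ ^ N • c) =O[𝓝 0] (fun ρ : 𝕜 => ρ ^ (N + 1))) : c = 0 := by
  obtain ⟨C, hC⟩ := h.bound
  have h1 : ∀ᶠ ρ : 𝕜 in 𝓝[≠] 0, ‖c‖ ≤ C * ‖ρ‖ := by
    filter_upwards [hC.filter_mono nhdsWithin_le_nhds, self_mem_nhdsWithin] with ρ hρ h0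
    have h0' : 0 < ‖ρ‖ ^ N := pow_pos (norm_pos_iff.mpr h0) N
    rw [norm_smul, norm_pow, norm_pow, pow_succ] at hρ
    exact le_of_mul_le_mul_left (by linarith) h0'
  have h2 : Tendsto (fun ρ : 𝕜 => C * ‖ρ‖) (𝓝[≠] 0) (𝓝 0) := by
    have : Tendsto (fun ρ : 𝕜 => C * ‖ρ‖) (𝓝 0) (𝓝 (C * ‖(0 : 𝕜)‖)) :=
      (continuous_const.mul continuous_norm).tendsto 0
    simp only [norm_zero, mul_zero] at this
    exact this.mono_left nhdsWithin_le_nhds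
  have h3 : ‖c‖ ≤ 0 := ge_of_tendsto h2 h1
  exact norm_le_zero_iff.mp h3

/-- Borel's lemma without smoothness: every sequence is the sequence of coefficients of some
asymptotic expansion. The `k`-th term of the formal series is switched off where it exceeds
`2⁻ᵏ ‖ρ‖ ^ (k - 1)`, which makes the series converge. -/
theorem exists_forall_sub_sum_isBigO {E : Type*} [NormedAddCommGroup E] [NormedSpace 𝕜 E]
    [CompleteSpace E] (b : ℕ → E) :
    ∃ F : 𝕜 → E, ∀ N : ℕ, (fun ρ : 𝕜 => F ρ - ∑ k ∈ Finset.range (N + 1), ρ ^ k • b k)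
      =O[𝓝 0] (fun ρ : 𝕜 => ρ ^ (N + 1)) := by
  classical
  let g : 𝕜 → ℕ → E := fun ρ k => if ‖b k‖ * ‖ρ‖ ≤ (1 / 2 : ℝ) ^ k then ρ ^ k • b k else 0
  have hg : ∀ (ρ : 𝕜) (k : ℕ), ‖g ρ (k + 1)‖ ≤ ‖ρ‖ ^ k * (1 / 2 : ℝ) ^ (k + 1) := by
    intro ρ k
    by_cases h : ‖b (k + 1)‖ * ‖ρ‖ ≤ (1 / 2 : ℝ) ^ (k + 1)
    · simp only [g, h, if_true, norm_smul, norm_pow]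
      calc ‖ρ‖ ^ (k + 1) * ‖b (k + 1)‖ = ‖ρ‖ ^ k * (‖b (k + 1)‖ * ‖ρ‖) := by ring
        _ ≤ _ := by gcongr
    · simp only [g, h, if_false, norm_zero]
      positivity
  have hsmall : ∀ᶠ ρ : 𝕜 in 𝓝 0, ‖ρ‖ < 1 := by
    filter_upwards [Metric.ball_mem_nhds (0 : 𝕜) one_pos] with ρ hρ
    simpa using hρ
  have hgeom : Summable fun k : ℕ => (1 / 2 : ℝ) ^ k := summable_geometric_two
  have hon : ∀ k, ∀ᶠ ρ : 𝕜 in 𝓝 0, g ρ k = ρ ^ k • b k := by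
    intro k
    have h1 : Tendsto (fun ρ : 𝕜 => ‖b k‖ * ‖ρ‖) (𝓝 0) (𝓝 (‖b k‖ * ‖(0 : 𝕜)‖)) :=
      (continuous_const.mul continuous_norm).tendsto 0
    have h2 : ‖b k‖ * ‖(0 : 𝕜)‖ < (1 / 2 : ℝ) ^ k := by
      rw [norm_zero, mul_zero]
      positivity
    filter_upwards [h1.eventually_lt_const h2] with ρ hρ
    simp only [g, hρ.le, if_true]
  have hgle : ∀ ρ : 𝕜, ‖ρ‖ < 1 → ∀ N k, ‖g ρ (k + (N + 2))‖ ≤ ‖ρ‖ ^ (N + 1) * (1 / 2 : ℝ) ^ k := by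
    intro ρ hρ N k
    refine (hg ρ (k + (N + 1))).trans ?_
    refine mul_le_mul ?_ ?_ (by positivity) (by positivity)
    · exact pow_le_pow_of_le_one (norm_nonneg _) hρ.le (by omega)
    · exact pow_le_pow_of_le_one (by norm_num) (by norm_num) (by omega)
  refine ⟨fun ρ => ∑' k, g ρ k, fun N => ?_⟩
  have h1 : (fun ρ : 𝕜 => ∑' k, g ρ (k + (N + 2))) =O[𝓝 0] (fun ρ : 𝕜 => ρ ^ (N + 1)) := by
    refine IsBigO.of_bound 2 ?_
    filter_upwards [hsmall] with ρ hρ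
    have := tsum_of_norm_bounded (hasSum_geometric_two.mul_left (‖ρ‖ ^ (N + 1))) (hgle ρ hρ N)
    rw [norm_pow]
    linarith
  have h2 := h1.add (isBigO_pow_smul (𝕜 := 𝕜) (N + 1) (b (N + 1)))
  refine h2.congr' ?_ EventuallyEq.rfl
  have hall : ∀ᶠ ρ : 𝕜 in 𝓝 0, ∀ k ∈ Finset.range (N + 2), g ρ k = ρ ^ k • b k :=
    (Filter.eventually_all_finset _).mpr fun k _ => hon k
  filter_upwards [hsmall, hall] with ρ hρ hk
  have hs : Summable (g ρ) := by
    rw [← summable_nat_add_iff 2]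
    exact Summable.of_norm_bounded (hgeom.mul_left (‖ρ‖ ^ (0 + 1))) (hgle ρ hρ 0)
  rw [← hs.sum_add_tsum_nat_add (N + 2), Finset.sum_congr rfl hk, Finset.sum_range_succ]
  abel

end Powers

section Expansions

variable {𝕜 : Type*} [RCLike 𝕜] [NormedAlgebra 𝕜 ℂ] {m : ℕ}

theorem HasFullExpansion.isBigO_sub {F : 𝕜 → Mat m} {a : ℕ → Mat m} (h : HasFullExpansion F a)
    (N : ℕ) : (fun ρ : 𝕜 => F ρ - ∑ k ∈ Finset.range N, ρ ^ k • a k)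
      =O[𝓝 0] (fun ρ : 𝕜 => ρ ^ N) := by
  have h1 := ((h N).trans (isBigO_pow_of_le N.le_succ)).add (isBigO_pow_smul (𝕜 := 𝕜) N (a N))
  refine h1.congr_left fun ρ => ?_
  rw [Finset.sum_range_succ]
  abel

theorem HasFullExpansion.isBigO_one {F : 𝕜 → Mat m} {a : ℕ → Mat m} (h : HasFullExpansion F a) :
    F =O[𝓝 0] (fun _ => (1 : 𝕜)) := by
  simpa using h.isBigO_sub 0

theorem HasFullExpansion.tendsto {F : 𝕜 → Mat m} {a : ℕ → Mat m} (h : HasFullExpansion F a) :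
    Tendsto F (𝓝 0) (𝓝 (a 0)) := by
  have h1 := h.isBigO_sub 1
  simp only [Finset.sum_range_one, pow_zero, one_smul, pow_one] at h1
  have h2 : Tendsto (fun ρ => F ρ - a 0) (𝓝 0) (𝓝 0) :=
    h1.trans_tendsto tendsto_id
  simpa using h2.add_const (a 0)

theorem HasFullExpansion.congr' {F G : 𝕜 → Mat m} {a : ℕ → Mat m} (h : HasFullExpansion F a)
    (hFG : F =ᶠ[𝓝 0] G) : HasFullExpansion G a := fun N =>
  (h N).congr' (hFG.mono fun ρ hρ => by simp only [hρ]) EventuallyEq.rfl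

theorem HasFullExpansion.sub {F G : 𝕜 → Mat m} {a b : ℕ → Mat m} (hF : HasFullExpansion F a)
    (hG : HasFullExpansion G b) :
    HasFullExpansion (fun ρ => F ρ - G ρ) (fun k => a k - b k) := fun N => by
  refine ((hF N).sub (hG N)).congr_left fun ρ => ?_
  simp only [smul_sub, Finset.sum_sub_distrib]
  abel

theorem HasFullExpansion.add {F G : 𝕜 → Mat m} {a b : ℕ → Mat m} (hF : HasFullExpansion F a)
    (hG : HasFullExpansion G b) :
    HasFullExpansion (fun ρ => F ρ + G ρ) (fun k => a k + b k) := fun N => by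
  refine ((hF N).add (hG N)).congr_left fun ρ => ?_
  simp only [smul_add, Finset.sum_add_distrib]
  abel

theorem hasFullExpansion_monomial (s : ℕ) (K : Mat m) :
    HasFullExpansion (fun ρ : 𝕜 => ρ ^ s • K)
      (fun k => PowerSeries.coeff k (PowerSeries.monomial s K)) := fun N => by
  simp only [PowerSeries.coeff_monomial, smul_ite, smul_zero, Finset.sum_ite_eq',
    Finset.mem_range]
  by_cases h : s < N + 1
  · simp only [h, if_true, sub_self]
    exact isBigO_zero _ _
  · simp only [h, if_false, sub_zero]
    exact (isBigO_pow_smul s K).trans (isBigO_pow_of_le (not_lt.mp h))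

theorem hasFullExpansion_const (K : Mat m) :
    HasFullExpansion (fun _ : 𝕜 => K) (fun k => PowerSeries.coeff k (PowerSeries.C K)) := by
  simpa [PowerSeries.monomial_zero_eq_C] using hasFullExpansion_monomial (𝕜 := 𝕜) 0 K

/-- Asymptotic expansions multiply like formal power series. -/
theorem HasFullExpansion.mul {F G : 𝕜 → Mat m} {φ ψ : (Mat m)⟦X⟧}
    (hF : HasFullExpansion F fun k => PowerSeries.coeff k φ)
    (hG : HasFullExpansion G fun k => PowerSeries.coeff k ψ) :
    HasFullExpansion (fun ρ => F ρ * G ρ) (fun k => PowerSeries.coeff k (φ * ψ)) := fun N => by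
  set a : ℕ → Mat m := fun k => PowerSeries.coeff k φ
  set b : ℕ → Mat m := fun k => PowerSeries.coeff k ψ
  have h1 := (hF N).mul hG.isBigO_one
  have h2 : (fun ρ : 𝕜 => ∑ i ∈ Finset.range (N + 1), (ρ ^ i • a i) *
      (G ρ - ∑ j ∈ Finset.range (N + 1 - i), ρ ^ j • b j)) =O[𝓝 0] (fun ρ : 𝕜 => ρ ^ (N + 1)) := by
    refine IsBigO.fun_sum fun i hi => ?_
    have h3 := (isBigO_pow_smul (𝕜 := 𝕜) i (a i)).mul (hG.isBigO_sub (N + 1 - i))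
    refine h3.congr_right fun ρ => ?_
    rw [← pow_add, Nat.add_sub_cancel' (Finset.mem_range.mp hi).le]
  simp only [mul_one] at h1
  refine (h1.add h2).congr_left fun ρ => ?_
  have h4 : ∑ k ∈ Finset.range (N + 1), ρ ^ k • PowerSeries.coeff k (φ * ψ) =
      ∑ i ∈ Finset.range (N + 1), (ρ ^ i • a i) *
        ∑ j ∈ Finset.range (N + 1 - i), ρ ^ j • b j := by
    simp only [Finset.mul_sum]
    rw [← Finset.sum_range_diag_flip (N + 1) fun i j => (ρ ^ i • a i) * (ρ ^ j • b j)]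
    refine Finset.sum_congr rfl fun k _ => ?_
    rw [PowerSeries.coeff_mul, Finset.Nat.sum_antidiagonal_eq_sum_range_succ_mk, Finset.smul_sum]
    refine Finset.sum_congr rfl fun i hi => ?_
    rw [smul_mul_smul_comm, ← pow_add,
      Nat.add_sub_cancel' (Nat.lt_succ_iff.mp (Finset.mem_range.mp hi))]
  rw [h4]
  simp only [mul_sub, sub_mul, Finset.sum_sub_distrib, Finset.sum_mul]
  abel

theorem HasFullExpansion.unique {F : 𝕜 → Mat m} {a b : ℕ → Mat m} (ha : HasFullExpansion F a)
    (hb : HasFullExpansion F b) : a = b := by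
  funext k
  induction k using Nat.strong_induction_on with
  | _ N ih =>
    refine sub_eq_zero.mp (eq_zero_of_pow_smul_isBigO (𝕜 := 𝕜) (N := N) ?_)
    refine ((hb N).sub (ha N)).congr_left fun ρ => ?_
    have h1 : ∑ k ∈ Finset.range N, ρ ^ k • a k = ∑ k ∈ Finset.range N, ρ ^ k • b k :=
      Finset.sum_congr rfl fun k hk => by rw [ih k (Finset.mem_range.mp hk)]
    rw [Finset.sum_range_succ, Finset.sum_range_succ, h1, smul_sub]
    abel

/-- A formal identity between expansions which vanish gives an error of infinite order. -/
theorem HasFullExpansion.isBigO_of_eq_zero {F : 𝕜 → Mat m} {a : ℕ → Mat m}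
    (h : HasFullExpansion F a) (ha : ∀ k, a k = 0) (N : ℕ) :
    F =O[𝓝 0] (fun ρ : 𝕜 => ρ ^ N) := by
  simpa [ha] using h.isBigO_sub N

theorem exists_hasFullExpansion (b : ℕ → Mat m) : ∃ F : 𝕜 → Mat m, HasFullExpansion F b :=
  exists_forall_sub_sum_isBigO b

theorem exists_hasFullExpansion_diagonal (d : ℕ → Fin m → ℂ) :
    ∃ f : 𝕜 → Fin m → ℂ,
      HasFullExpansion (fun ρ => Matrix.diagonal (f ρ)) (fun k => Matrix.diagonal (d k)) := by
  obtain ⟨f, hf⟩ := exists_forall_sub_sum_isBigO (𝕜 := 𝕜) d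
  refine ⟨f, fun N => ((hf N).norm_left.congr_left fun ρ => ?_).of_norm_left⟩
  rw [← Matrix.linfty_opNorm_diagonal]
  congr 1
  ext i j
  rcases eq_or_ne i j with rfl | h
  · simp [Matrix.sum_apply]
  · simp [Matrix.sum_apply, h]

end Expansions

/-! ### The scheme on the level of formal power series -/

section Formal

open PowerSeries

theorem coeff_mul_congr_right {R : Type*} [Semiring R] {N : ℕ} (φ : R⟦X⟧) {ψ ψ' : R⟦X⟧}
    (h : ∀ j < N, coeff j ψ = coeff j ψ') : ∀ j < N, coeff j (φ * ψ) = coeff j (φ * ψ') := by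
  intro j hj
  rw [coeff_mul, coeff_mul]
  refine Finset.sum_congr rfl fun p hp => ?_
  rw [h p.2 (by have := Finset.HasAntidiagonal.mem_antidiagonal.mp hp; omega)]

theorem coeff_mul_congr_left {R : Type*} [Semiring R] {N : ℕ} {φ φ' : R⟦X⟧} (ψ : R⟦X⟧)
    (h : ∀ j < N, coeff j φ = coeff j φ') : ∀ j < N, coeff j (φ * ψ) = coeff j (φ' * ψ) := by
  intro j hj
  rw [coeff_mul, coeff_mul]
  refine Finset.sum_congr rfl fun p hp => ?_
  rw [h p.1 (by have := Finset.HasAntidiagonal.mem_antidiagonal.mp hp; omega)]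

/-- Left cancellation modulo `X ^ N` of a series with invertible constant term. -/
theorem coeff_eq_of_coeff_mul_eq {R : Type*} [Ring R] {N : ℕ} {φ ψ ψ' : R⟦X⟧}
    (hφ : IsUnit (coeff 0 φ)) (h : ∀ j < N, coeff j (φ * ψ) = coeff j (φ * ψ')) :
    ∀ j < N, coeff j ψ = coeff j ψ' := by
  intro j
  induction j using Nat.strong_induction_on with
  | _ j ih =>
    intro hj
    have h1 := h j hj
    rw [coeff_mul, coeff_mul, Finset.Nat.sum_antidiagonal_eq_sum_range_succ_mk,
      Finset.Nat.sum_antidiagonal_eq_sum_range_succ_mk, Finset.sum_range_succ',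
      Finset.sum_range_succ'] at h1
    have h2 : ∑ i ∈ Finset.range j, coeff (i + 1) φ * coeff (j - (i + 1)) ψ =
        ∑ i ∈ Finset.range j, coeff (i + 1) φ * coeff (j - (i + 1)) ψ' := by
      refine Finset.sum_congr rfl fun i hi => ?_
      have := Finset.mem_range.mp hi
      rw [ih (j - (i + 1)) (by omega) (by omega)]
    rw [h2] at h1
    exact hφ.mul_left_cancel (add_left_cancel h1)

/-- One factor `1 + X ^ s K` of a step: it leaves the coefficients below `k + 1` alone if these
commute with `K`, and changes the coefficient of `X ^ (k + 1)` by the commutator of `K` with the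
coefficient of `X ^ ℓ`, where `ℓ + s = k + 1`. -/
theorem coeff_mul_one_add_eq {R : Type*} [Ring R] {k ℓ s : ℕ} (hs : ℓ + s = k + 1) (hℓ : ℓ ≤ k)
    {φ ψ : R⟦X⟧} {K : R} (hφψ : ∀ j ≤ k, coeff j φ = coeff j ψ)
    (hcomm : ∀ j < ℓ, coeff j φ * K = K * coeff j φ)
    (htop : coeff (k + 1) φ + coeff ℓ φ * K = coeff (k + 1) ψ + K * coeff ℓ φ) :
    ∀ j < k + 2, coeff j (φ * (1 + C K * X ^ s)) = coeff j ((1 + C K * X ^ s) * ψ) := by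
  intro j hj
  have e1 : φ * (1 + C K * X ^ s) = φ + φ * C K * X ^ s := by rw [mul_add, mul_one, mul_assoc]
  have e2 : (1 + C K * X ^ s) * ψ = ψ + C K * ψ * X ^ s := by
    rw [add_mul, one_mul, mul_assoc, mul_assoc, ((commute_X_pow ψ s).eq)]
  rw [e1, e2, map_add, map_add, coeff_mul_X_pow', coeff_mul_X_pow']
  rcases Nat.lt_or_ge j (k + 1) with h | h
  · rw [hφψ j (by omega)]
    by_cases hsj : s ≤ j
    · rw [if_pos hsj, if_pos hsj, coeff_mul_C, coeff_C_mul, hcomm _ (by omega),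
        hφψ _ (by omega)]
    · rw [if_neg hsj, if_neg hsj]
  · obtain rfl : j = k + 1 := by omega
    have : k + 1 - s = ℓ := by omega
    rw [if_pos (by omega), if_pos (by omega), coeff_mul_C, coeff_C_mul, this, htop,
      hφψ ℓ hℓ]

/-- A block-diagonal matrix commutes with a diagonal matrix which is constant on the blocks. -/
theorem IsBlockDiagonal.diagonal_comm {m : ℕ} {r : Fin m → Fin m → Prop} {K : Mat m}
    (hK : IsBlockDiagonal r K) {d : Fin m → ℂ} (hd : ∀ i j, r i j → d i = d j) :
    Matrix.diagonal d * K = K * Matrix.diagonal d := by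
  ext i j
  rw [Matrix.diagonal_mul, Matrix.mul_diagonal]
  by_cases h : r i j
  · rw [hd i j h, mul_comm]
  · rw [hK i j h, mul_zero, zero_mul]

/-- The formal counterpart of the product `(1 + ρ ^ (k + 1) K 0) (1 + ρ ^ k K 1) ⋯` of the first
`l` factors of a step transformation. -/
noncomputable def formalProd {m : ℕ} (k : ℕ) (K : ℕ → Mat m) (l : ℕ) : (Mat m)⟦X⟧ :=
  ((List.range l).map fun ℓ => 1 + C (K ℓ) * X ^ (k + 1 - ℓ)).prod

theorem formalProd_succ {m : ℕ} (k : ℕ) (K : ℕ → Mat m) (l : ℕ) :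
    formalProd k K (l + 1) = formalProd k K l * (1 + C (K l) * X ^ (k + 1 - l)) := by
  simp [formalProd, List.range_succ]

theorem coeff_zero_formalProd {m : ℕ} (k : ℕ) (K : ℕ → Mat m) (l : ℕ) (hl : l ≤ k + 1) :
    coeff 0 (formalProd k K l) = 1 := by
  induction l with
  | zero => simp [formalProd]
  | succ l ih =>
    have : k + 1 - l ≠ 0 := by omega
    have h0 := ih (by omega)
    simp only [coeff_zero_eq_constantCoeff, formalProd_succ, map_mul, map_add, map_one, map_pow,
      constantCoeff_X, zero_pow this, mul_zero, add_zero, mul_one] at h0 ⊢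
    exact h0

/-- The step from level `k` to level `k + 1`, formally: if `φ` has the diagonal coefficients
`Λ_0, …, Λ_k`, the step produces a series with coefficients `Λ_0, …, Λ_{k + 1}`. -/
theorem coeff_step {m : ℕ} {k : ℕ} {lam : ℕ → Fin m → ℂ} {K : ℕ → Mat m} {M : Mat m}
    {φ ψ : (Mat m)⟦X⟧} (hφ : ∀ j ≤ k, coeff j φ = Matrix.diagonal (lam j))
    (hK : ∀ ℓ ≤ k, IsBlockDiagonal (SameBlock lam ℓ) (K ℓ))
    (hKs : ∀ ℓ ≤ k, (Matrix.diagonal (lam ℓ) * K ℓ - K ℓ * Matrix.diagonal (lam ℓ))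
      + subBlock lam (coeff (k + 1) φ) ℓ - subBlock lam (coeff (k + 1) φ) (ℓ + 1) = 0)
    (hM : IsUnit M) (hMb : IsBlockDiagonal (SameBlock lam (k + 1)) M)
    (hMd : M⁻¹ * subBlock lam (coeff (k + 1) φ) (k + 1) * M = Matrix.diagonal (lam (k + 1)))
    (hψ : (formalProd k K (k + 1) * C M) * ψ = φ * (formalProd k K (k + 1) * C M)) :
    ∀ j ≤ k + 1, coeff j ψ = Matrix.diagonal (lam j) := by
  let D : Mat m → (Mat m)⟦X⟧ := fun B =>
    PowerSeries.mk fun j => if j ≤ k then Matrix.diagonal (lam j) else B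
  have hD : ∀ B, ∀ j ≤ k, coeff j (D B) = Matrix.diagonal (lam j) := fun B j hj => by
    simp [D, hj]
  have hDt : ∀ B, coeff (k + 1) (D B) = B := fun B => by simp [D]
  -- The first `l` factors replace the remainder by its `l`-th block-diagonal part.
  have key : ∀ l ≤ k + 1, ∀ j < k + 2, coeff j (φ * formalProd k K l) =
      coeff j (formalProd k K l * D (subBlock lam (coeff (k + 1) φ) l)) := by
    intro l
    induction l with
    | zero =>
      intro _ j hj
      simp only [formalProd, List.range_zero, List.map_nil, List.prod_nil, mul_one, one_mul]
      rcases Nat.lt_or_ge j (k + 1) with h | h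
      · rw [hφ j (by omega), hD _ j (by omega)]
      · obtain rfl : j = k + 1 := by omega
        rw [hDt, subBlock]
    | succ l ih =>
      intro hl j hj
      have h1 := coeff_mul_congr_left (1 + C (K l) * X ^ (k + 1 - l)) (ih (by omega)) j hj
      rw [formalProd_succ, ← mul_assoc, h1, mul_assoc, mul_assoc]
      refine coeff_mul_congr_right _ (coeff_mul_one_add_eq (k := k) (ℓ := l) (by omega) (by omega)
        (fun j hj => by rw [hD _ j hj, hD _ j hj]) (fun j hj => ?_) ?_) j hj
      · rw [hD _ j (by omega)]
        exact (hK l (by omega)).diagonal_comm fun p q hpq => hpq j hj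
      · rw [hDt, hDt, hD _ l (by omega)]
        have := hKs l (by omega)
        rw [sub_add_eq_add_sub, sub_sub, sub_eq_zero] at this
        rw [add_comm, this, add_comm]
  have hM' : IsUnit M.det := (Matrix.isUnit_iff_isUnit_det M).mp hM
  have hfin : ∀ j < k + 2, coeff j ((formalProd k K (k + 1) * C M) * ψ) =
      coeff j ((formalProd k K (k + 1) * C M) * D (Matrix.diagonal (lam (k + 1)))) := by
    intro j hj
    rw [hψ, ← mul_assoc, coeff_mul_congr_left (C M) (key (k + 1) le_rfl) j hj, mul_assoc, mul_assoc]
    refine coeff_mul_congr_right _ (fun j hj => ?_) j hj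
    rw [coeff_mul_C, coeff_C_mul]
    rcases Nat.lt_or_ge j (k + 1) with h | h
    · rw [hD _ j (by omega), hD _ j (by omega)]
      exact hMb.diagonal_comm fun p q hpq => hpq j h
    · obtain rfl : j = k + 1 := by omega
      rw [hDt, hDt, ← hMd, mul_assoc, Matrix.mul_nonsing_inv_cancel_left _ _ hM']
  have hunit : IsUnit (coeff 0 (formalProd k K (k + 1) * C M)) := by
    rw [coeff_mul_C, coeff_zero_formalProd k K _ le_rfl, one_mul]
    exact hM
  intro j hj
  rw [coeff_eq_of_coeff_mul_eq hunit hfin j (by omega)]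
  rcases Nat.lt_or_ge j (k + 1) with h | h
  · exact hD _ j (by omega)
  · obtain rfl : j = k + 1 := by omega
    exact hDt _

end Formal

section Run

variable {𝕜 : Type*} [RCLike 𝕜] [NormedAlgebra 𝕜 ℂ] {m : ℕ}

theorem hasFullExpansion_stepTransform (k : ℕ) (K : ℕ → Mat m) (M : Mat m) :
    HasFullExpansion (stepTransform k K M : 𝕜 → Mat m)
      (fun j => PowerSeries.coeff j (formalProd k K (k + 1) * PowerSeries.C M)) := by
  have h : ∀ l, HasFullExpansion
      (fun ρ : 𝕜 => ((List.range l).map fun ℓ => 1 + ρ ^ (k + 1 - ℓ) • K ℓ).prod)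
      (fun j => PowerSeries.coeff j (formalProd k K l)) := by
    intro l
    induction l with
    | zero => simpa [formalProd] using hasFullExpansion_const (𝕜 := 𝕜) (1 : Mat m)
    | succ l ih =>
      have h1 := (hasFullExpansion_const (𝕜 := 𝕜) (1 : Mat m)).add
        (hasFullExpansion_monomial (𝕜 := 𝕜) (k + 1 - l) (K l))
      have h2 := ih.mul (ψ := 1 + PowerSeries.C (K l) * PowerSeries.X ^ (k + 1 - l)) (by
        simpa [PowerSeries.monomial_eq_C_mul_X_pow] using h1)
      simpa [formalProd_succ, List.range_succ] using h2
  exact (h (k + 1)).mul (hasFullExpansion_const M)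

theorem HasFullExpansion.eventually_isUnit {F : 𝕜 → Mat m} {a : ℕ → Mat m}
    (h : HasFullExpansion F a) (h0 : IsUnit (a 0)) : ∀ᶠ ρ in 𝓝 0, IsUnit (F ρ) :=
  h.tendsto.eventually (Units.isOpen.mem_nhds h0)

namespace SchemeRun

variable {A : 𝕜 → Mat m} {a : ℕ → Mat m} {n : ℕ}

/-- The coefficients of `Ã^{[k]}` as a formal power series. -/
noncomputable def series (S : SchemeRun A a n) (k : ℕ) : (Mat m)⟦X⟧ := PowerSeries.mk (S.coef k)

/-- The formal transformation of the step from level `k` to level `k + 1`. -/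
noncomputable def formalStep (S : SchemeRun A a n) (k : ℕ) : (Mat m)⟦X⟧ :=
  formalProd k (S.K k) (k + 1) * PowerSeries.C (S.M (k + 1))

theorem coeff_zero_formalStep (S : SchemeRun A a n) (k : ℕ) :
    PowerSeries.coeff 0 (S.formalStep k) = S.M (k + 1) := by
  rw [formalStep, PowerSeries.coeff_mul_C, coeff_zero_formalProd _ _ _ le_rfl, one_mul]

theorem hasFullExpansion_series (S : SchemeRun A a n) {k : ℕ} (hk : k ≤ n) :
    HasFullExpansion (S.fam k) fun j => PowerSeries.coeff j (S.series k) := by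
  simpa [series] using S.fam_expansion k hk

theorem C_mul_series_zero (S : SchemeRun A a n) (ha : HasFullExpansion A a) :
    PowerSeries.C (S.M 0) * S.series 0 = PowerSeries.mk a * PowerSeries.C (S.M 0) := by
  have h1 := (hasFullExpansion_const (S.M 0)).mul (S.hasFullExpansion_series n.zero_le)
  have ha' : HasFullExpansion A fun j => PowerSeries.coeff j (PowerSeries.mk a) := by
    simpa using ha
  have h2 := ha'.mul (hasFullExpansion_const (S.M 0))
  have hM := (Matrix.isUnit_iff_isUnit_det _).mp (S.M_isUnit 0 n.zero_le)
  ext1 j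
  refine congrFun (h1.unique (h2.congr' (Eventually.of_forall fun ρ => ?_))) j
  simp only [S.fam_zero, mul_assoc, Matrix.mul_nonsing_inv_cancel_left _ _ hM]

theorem formalStep_mul_series (S : SchemeRun A a n) {k : ℕ} (hk : k < n) :
    S.formalStep k * S.series (k + 1) = S.series k * S.formalStep k := by
  have hT := hasFullExpansion_stepTransform (𝕜 := 𝕜) k (S.K k) (S.M (k + 1))
  have h1 := hT.mul (S.hasFullExpansion_series (Nat.succ_le_of_lt hk))
  have h2 := (S.hasFullExpansion_series hk.le).mul hT
  have h0 := S.coeff_zero_formalStep k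
  rw [formalStep] at h0
  have hu := hT.eventually_isUnit (by rw [h0]; exact S.M_isUnit (k + 1) hk)
  ext1 j
  refine congrFun (h1.unique (h2.congr' ?_)) j
  filter_upwards [hu] with ρ hρ
  rw [S.fam_succ k hk, mul_assoc,
    Matrix.mul_nonsing_inv_cancel_left _ _ ((Matrix.isUnit_iff_isUnit_det _).mp hρ)]

/-- The family `Ã^{[k]}` is diagonal modulo `ρ ^ (k + 1)`, with coefficients `Λ_0, …, Λ_k`. -/
theorem coeff_series (S : SchemeRun A a n) (ha : HasFullExpansion A a) :
    ∀ k ≤ n, ∀ j ≤ k, PowerSeries.coeff j (S.series k) = Matrix.diagonal (S.lam j) := by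
  intro k
  induction k with
  | zero =>
    intro _ j hj
    obtain rfl : j = 0 := by omega
    have h1 := congrArg (PowerSeries.coeff 0) (S.C_mul_series_zero ha)
    have hM := (Matrix.isUnit_iff_isUnit_det _).mp (S.M_isUnit 0 n.zero_le)
    rw [PowerSeries.coeff_C_mul, PowerSeries.coeff_mul_C, PowerSeries.coeff_mk] at h1
    have h2 := S.M_diag 0 n.zero_le
    rw [tildeLambda, mul_assoc, ← h1, Matrix.nonsing_inv_mul_cancel_left _ _ hM] at h2
    exact h2
  | succ k ih =>
    intro hk
    have hcoef : PowerSeries.coeff (k + 1) (S.series k) = S.coef k (k + 1) := by simp [series]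
    refine coeff_step (ih (by omega)) (S.K_block k hk) ?_ (S.M_isUnit (k + 1) hk)
      (S.M_block (k + 1) hk) ?_ (S.formalStep_mul_series hk)
    · rw [hcoef]
      exact S.K_sylvester k hk
    · rw [hcoef]
      exact S.M_diag (k + 1) hk

/-- The product of all formal transformations up to level `k`. -/
noncomputable def formalTransform (S : SchemeRun A a n) : ℕ → (Mat m)⟦X⟧
  | 0 => PowerSeries.C (S.M 0)
  | k + 1 => S.formalTransform k * S.formalStep k

theorem formalTransform_mul_series (S : SchemeRun A a n) (ha : HasFullExpansion A a) :
    ∀ k ≤ n, S.formalTransform k * S.series k = PowerSeries.mk a * S.formalTransform k := by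
  intro k
  induction k with
  | zero => exact fun _ => S.C_mul_series_zero ha
  | succ k ih =>
    intro hk
    rw [formalTransform, mul_assoc, S.formalStep_mul_series hk, ← mul_assoc, ih (by omega),
      mul_assoc]

theorem isUnit_coeff_zero_formalTransform (S : SchemeRun A a n) :
    ∀ k ≤ n, IsUnit (PowerSeries.coeff 0 (S.formalTransform k)) := by
  intro k
  induction k with
  | zero => simpa [formalTransform] using S.M_isUnit 0
  | succ k ih =>
    intro hk
    have h1 := ih (by omega)
    have h2 := S.M_isUnit (k + 1) hk
    rw [← S.coeff_zero_formalStep k] at h2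
    simp only [PowerSeries.coeff_zero_eq_constantCoeff] at h1 h2 ⊢
    rw [formalTransform, map_mul]
    exact h1.mul h2

end SchemeRun

end Run

/-! ### Formal diagonalisation -/

section FormalDiagonalisation

open PowerSeries

/-- Contraction principle for the `X`-adic topology on tuples of power series. -/
theorem exists_fixed_point_of_coeff_contraction {ι R : Type*} [Semiring R]
    (Φ : (ι → R⟦X⟧) → ι → R⟦X⟧)
    (hΦ : ∀ (k : ℕ) (v w : ι → R⟦X⟧), (∀ i, ∀ j < k, coeff j (v i) = coeff j (w i)) →
      ∀ i, ∀ j < k + 1, coeff j (Φ v i) = coeff j (Φ w i)) :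
    ∃ v, Φ v = v := by
  let s : ℕ → ι → R⟦X⟧ := fun t => Φ^[t] 0
  have hs : ∀ t, s (t + 1) = Φ (s t) := fun t => Function.iterate_succ_apply' Φ t 0
  have h1 : ∀ t i, ∀ j < t, coeff j (s t i) = coeff j (s (t + 1) i) := by
    intro t
    induction t with
    | zero => intro i j hj; omega
    | succ t ih =>
      rw [hs t, hs (t + 1)]
      exact hΦ t _ _ ih
  have h2 : ∀ d t i, ∀ j < t, coeff j (s t i) = coeff j (s (t + d) i) := by
    intro d
    induction d with
    | zero => exact fun t i j _ => rfl
    | succ d ih => exact fun t i j hj => (ih t i j hj).trans (h1 (t + d) i j (by omega))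
  let v : ι → R⟦X⟧ := fun i => PowerSeries.mk fun k => coeff k (s (k + 1) i)
  have h3 : ∀ t i, ∀ j < t, coeff j (v i) = coeff j (s t i) := by
    intro t i j hj
    obtain ⟨d, rfl⟩ := Nat.exists_eq_add_of_le (Nat.succ_le_of_lt hj)
    rw [coeff_mk]
    exact h2 d (j + 1) i j j.lt_succ_self
  refine ⟨v, funext fun i => PowerSeries.ext fun t => ?_⟩
  rw [hΦ t v (s t) (h3 t) i t t.lt_succ_self, ← hs t, h3 (t + 1) i t t.lt_succ_self]

/-- A matrix over the ring of formal power series whose off-diagonal entries are divisible by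
`X ^ (n + 1)`, while the differences of diagonal entries have order at most `n`, has for each `i`
an eigenvector congruent to the `i`-th unit vector modulo `X`. With `B = diag + X ^ (n + 1) R`
and the normalisation `v i = 1` the eigenvector equation is, after division by
`B i i - B j j`, a fixed point equation for an `X`-adic contraction. -/
theorem exists_formal_eigenvector {R ι : Type*} [CommRing R] [Fintype ι] [DecidableEq ι] {n : ℕ}
    (B : Matrix ι ι R⟦X⟧) (hoff : ∀ i j, i ≠ j → X ^ (n + 1) ∣ B i j)
    (hdiag : ∀ i j, i ≠ j → B i i - B j j ∣ X ^ n) (i : ι) :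
    ∃ (v : ι → R⟦X⟧) (δ : R⟦X⟧), B.mulVec v = δ • v ∧ v i = 1 ∧
      (∀ j, j ≠ i → coeff 0 (v j) = 0) ∧ X ^ (n + 1) ∣ δ - B i i := by
  have hR : ∀ j l, ∃ r, B j l = (if j = l then B j j else 0) + X ^ (n + 1) * r := by
    intro j l
    by_cases h : j = l
    · exact ⟨0, by simp [h]⟩
    · obtain ⟨r, hr⟩ := hoff j l h
      exact ⟨r, by simp [h, hr]⟩
  choose r hr using hR
  have hc : ∀ j, ∃ c, j ≠ i → X ^ n = (B i i - B j j) * c := by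
    intro j
    by_cases h : j = i
    · exact ⟨0, fun h' => absurd h h'⟩
    · obtain ⟨c, hc⟩ := hdiag i j (Ne.symm h)
      exact ⟨c, fun _ => hc⟩
  choose c hc using hc
  let G : (ι → R⟦X⟧) → ι → R⟦X⟧ := fun v j =>
    c j * (∑ l, r j l * v l - v j * ∑ l, r i l * v l)
  let Φ : (ι → R⟦X⟧) → ι → R⟦X⟧ := fun v j => if j = i then 1 else X * G v j
  have hΦ : ∃ v, Φ v = v := by
    refine exists_fixed_point_of_coeff_contraction Φ fun k v w hvw j t ht => ?_
    by_cases hj : j = i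
    · simp [Φ, hj]
    · have hdvd : ∀ l, X ^ k ∣ v l - w l := fun l => X_pow_dvd_iff.mpr fun t ht => by
        rw [map_sub, hvw l t ht, sub_self]
      have hsum : ∀ j, X ^ k ∣ ∑ l, r j l * v l - ∑ l, r j l * w l := fun j => by
        rw [← Finset.sum_sub_distrib]
        refine Finset.dvd_sum fun l _ => ?_
        rw [← mul_sub]
        exact (hdvd l).mul_left _
      have hG : X ^ k ∣ G v j - G w j := by
        have e : G v j - G w j = c j * ((∑ l, r j l * v l - ∑ l, r j l * w l)
            - ((v j - w j) * ∑ l, r i l * v l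
              + w j * (∑ l, r i l * v l - ∑ l, r i l * w l))) := by
          simp only [G]
          ring
        rw [e]
        exact ((hsum j).sub (((hdvd j).mul_right _).add ((hsum i).mul_left _))).mul_left _
      have hX : X ^ (k + 1) ∣ X * G v j - X * G w j := by
        rw [← mul_sub, pow_succ']
        exact mul_dvd_mul_left X hG
      have := X_pow_dvd_iff.mp hX t ht
      simp only [Φ, hj, if_false]
      rwa [map_sub, sub_eq_zero] at this
  obtain ⟨v, hv⟩ := hΦ
  have hvi : v i = 1 := by rw [← hv]; simp [Φ]
  have hvj : ∀ j, j ≠ i → v j = X * G v j := fun j hj => by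
    conv_lhs => rw [← hv]
    simp [Φ, hj]
  have hBv : ∀ j, B.mulVec v j = B j j * v j + X ^ (n + 1) * ∑ l, r j l * v l := by
    intro j
    simp only [Matrix.mulVec, dotProduct]
    rw [Finset.sum_congr rfl fun l _ => by rw [hr j l, add_mul, ite_mul, zero_mul],
      Finset.sum_add_distrib, Finset.sum_ite_eq, if_pos (Finset.mem_univ _), Finset.mul_sum]
    simp only [mul_assoc]
  refine ⟨v, B i i + X ^ (n + 1) * ∑ l, r i l * v l, funext fun j => ?_, hvi, ?_, ?_⟩
  · rw [hBv, Pi.smul_apply, smul_eq_mul]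
    by_cases hj : j = i
    · rw [hj, hvi]
      ring
    · have h1 : (B i i - B j j) * v j =
          X ^ (n + 1) * (∑ l, r j l * v l - v j * ∑ l, r i l * v l) := by
        conv_lhs => rw [hvj j hj]
        simp only [G]
        rw [pow_succ, hc j hj]
        ring
      linear_combination -h1
  · intro j hj
    rw [hvj j hj, coeff_zero_X_mul]
  · simp

theorem dvd_X_pow_of_coeff_ne_zero {K : Type*} [Field K] {φ : K⟦X⟧} {n k : ℕ} (hk : k ≤ n)
    (h : coeff k φ ≠ 0) : φ ∣ X ^ n := by
  have hφ : φ ≠ 0 := by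
    rintro rfl
    simp at h
  have h1 : φ.order.toNat ≤ k := by
    have := order_le k h
    exact ENat.toNat_le_of_le_natCast this
  have h2 : φ ∣ X ^ φ.order.toNat := by
    have h3 : IsUnit (divXPowOrder φ) := by
      rw [isUnit_iff_constantCoeff, constantCoeff_divXPowOrder]
      exact (coeff_order hφ).isUnit
    obtain ⟨u, hu⟩ := h3
    refine ⟨↑u⁻¹, ?_⟩
    conv_rhs => rw [← X_pow_order_mul_divXPowOrder (f := φ), ← hu]
    simp
  exact h2.trans (pow_dvd_pow X (h1.trans hk))

/-- Formal diagonalisation of a series of matrices which is diagonal modulo `X ^ (n + 1)` and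
whose diagonal entries differ pairwise modulo `X ^ (n + 1)`. -/
theorem exists_formal_diagonalisation {m n : ℕ} {lam : ℕ → Fin m → ℂ} (φ : (Mat m)⟦X⟧)
    (hφ : ∀ j ≤ n, coeff j φ = Matrix.diagonal (lam j))
    (hsep : ∀ i j, i ≠ j → ∃ k ≤ n, lam k i ≠ lam k j) :
    ∃ (P : (Mat m)⟦X⟧) (d : ℕ → Fin m → ℂ), coeff 0 P = 1 ∧
      φ * P = P * PowerSeries.mk (fun k => Matrix.diagonal (d k)) ∧ ∀ k ≤ n, d k = lam k := by
  let B : Matrix (Fin m) (Fin m) ℂ⟦X⟧ := fun i j => PowerSeries.mk fun k => coeff k φ i j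
  have hB : ∀ k i j, coeff k (B i j) = coeff k φ i j := fun k i j => coeff_mk _ _
  have hev := exists_formal_eigenvector (n := n) B
    (fun i j hij => X_pow_dvd_iff.mpr fun k hk => by
      rw [hB, hφ k (by omega), Matrix.diagonal_apply_ne _ hij])
    (fun i j hij => by
      obtain ⟨k, hk, hne⟩ := hsep i j hij
      refine dvd_X_pow_of_coeff_ne_zero hk ?_
      rw [map_sub, hB, hB, hφ k hk, Matrix.diagonal_apply_eq, Matrix.diagonal_apply_eq]
      exact sub_ne_zero.mpr hne)
  choose v δ hBv hvi hvj hδ using hev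
  refine ⟨PowerSeries.mk fun k => Matrix.of fun i j => coeff k (v j i),
    fun k i => coeff k (δ i), ?_, ?_, ?_⟩
  · ext i j
    rw [coeff_mk, Matrix.of_apply]
    rcases eq_or_ne i j with rfl | h
    · rw [hvi, Matrix.one_apply_eq, coeff_zero_one]
    · rw [hvj j i h, Matrix.one_apply_ne h]
  · ext k i j
    have h1 := congrArg (coeff k) (congrFun (hBv j) i)
    simp only [Matrix.mulVec, dotProduct, map_sum, Pi.smul_apply, smul_eq_mul] at h1
    rw [mul_comm (δ j)] at h1
    simp only [coeff_mul, hB] at h1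
    rw [Finset.sum_comm] at h1
    simp only [coeff_mul, coeff_mk, Matrix.sum_apply, Matrix.mul_diagonal, Matrix.of_apply]
    rw [← h1]
    simp only [Matrix.mul_apply, Matrix.of_apply]
  · intro k hk
    funext i
    have h1 := X_pow_dvd_iff.mp (hδ i) k (by omega)
    rw [map_sub, hB, hφ k hk, Matrix.diagonal_apply_eq, sub_eq_zero] at h1
    exact h1

end FormalDiagonalisation

/-- Formal solution of the diagonalisation problem: a run whose `Λ_0, …, Λ_n` separate the indices
gives a formal diagonaliser of the expansion of `A`, with eigenvalues `∑ X ^ k λ^{[k]}` modulo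
`X ^ (n + 1)`. -/
theorem SchemeRun.exists_formal_diagonaliser {𝕜 : Type*} [RCLike 𝕜] [NormedAlgebra 𝕜 ℂ] {m : ℕ}
    {A : 𝕜 → Mat m} {a : ℕ → Mat m} {n : ℕ} (S : SchemeRun A a n) (ha : HasFullExpansion A a)
    (hsep : ∀ i j, i ≠ j → ∃ k ≤ n, S.lam k i ≠ S.lam k j) :
    ∃ (Q : (Mat m)⟦X⟧) (d : ℕ → Fin m → ℂ), IsUnit (PowerSeries.coeff 0 Q) ∧
      PowerSeries.mk a * Q = Q * PowerSeries.mk (fun k => Matrix.diagonal (d k)) ∧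
      ∀ k ≤ n, d k = S.lam k := by
  obtain ⟨P, d, hP0, hP, hd⟩ :=
    exists_formal_diagonalisation (S.series n) (S.coeff_series ha n le_rfl) hsep
  refine ⟨S.formalTransform n * P, d, ?_, ?_, hd⟩
  · have h := S.isUnit_coeff_zero_formalTransform n le_rfl
    simp only [PowerSeries.coeff_zero_eq_constantCoeff] at h hP0 ⊢
    rw [map_mul, hP0, mul_one]
    exact h
  · rw [← mul_assoc, ← S.formalTransform_mul_series ha n le_rfl, mul_assoc, hP, mul_assoc]

/-! ### Separation of the indices and Borel summation -/

section Separation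

/-- A matrix similar to `diagonal d` is non-degenerate if and only if the `d p` are distinct. -/
theorem nonDegenerate_iff_injective {ι : Type*} [Fintype ι] [DecidableEq ι] {B M N : Matrix ι ι ℂ}
    {d : ι → ℂ} (hNM : N * M = 1) (hB : B * M = M * Matrix.diagonal d) :
    NonDegenerate B ↔ Function.Injective d := by
  have hMN : M * N = 1 := mul_eq_one_comm.mp hNM
  let u : (Matrix ι ι ℂ)ˣ := ⟨M, N, hMN, hNM⟩
  have h1 : B = (u : Matrix ι ι ℂ) * Matrix.diagonal d * (↑u⁻¹ : Matrix ι ι ℂ) := by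
    change B = M * Matrix.diagonal d * N
    rw [← hB, mul_assoc, hMN, mul_one]
  have h2 : spectrum ℂ B = Set.range d := by
    rw [h1, spectrum.units_conjugate, spectrum_diagonal]
  unfold NonDegenerate
  rw [h2, ← Set.image_univ, ← Nat.card_eq_fintype_card, ← Set.ncard_univ,
    Set.ncard_image_iff Set.finite_univ, Set.injOn_univ]

theorem SameBlock.trans {m : ℕ} {lam : ℕ → Fin m → ℂ} {k : ℕ} {i j l : Fin m}
    (h : SameBlock lam k i j) (h' : SameBlock lam k j l) : SameBlock lam k i l :=
  fun k' hk' => (h k' hk').trans (h' k' hk')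

theorem SameBlock.symm {m : ℕ} {lam : ℕ → Fin m → ℂ} {k : ℕ} {i j : Fin m}
    (h : SameBlock lam k i j) : SameBlock lam k j i :=
  fun k' hk' => (h k' hk').symm

/-- Restricting to one block is multiplicative if the right factor is block-diagonal. -/
theorem submatrix_mul_of_isBlockDiagonal {m : ℕ} {lam : ℕ → Fin m → ℂ} {k : ℕ} (i : Fin m)
    [Fintype {j : Fin m // SameBlock lam k i j}] (B : Mat m) {M : Mat m}
    (hM : IsBlockDiagonal (SameBlock lam k) M) :
    (Matrix.of fun p q : {j : Fin m // SameBlock lam k i j} => (B * M) p.1 q.1) =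
      (Matrix.of fun p q : {j : Fin m // SameBlock lam k i j} => B p.1 q.1) *
        Matrix.of fun p q : {j : Fin m // SameBlock lam k i j} => M p.1 q.1 := by
  classical
  ext p q
  simp only [Matrix.of_apply, Matrix.mul_apply]
  rw [← Finset.sum_subtype (Finset.univ.filter fun j => SameBlock lam k i j) (by simp)
    (fun j => B p j * M j q)]
  refine (Finset.sum_filter_of_ne fun j _ hj => ?_).symm
  by_contra h
  exact hj (by rw [hM j q fun h' => h (q.2.trans h'.symm), mul_zero])

variable {𝕜 : Type*} [RCLike 𝕜] [NormedAlgebra 𝕜 ℂ] {m : ℕ} {A : 𝕜 → Mat m} {a : ℕ → Mat m} {n : ℕ}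

/-- The diagonal block of `Λ̃_n` that contains the index `i` is similar to the corresponding block of
`Λ_n`, hence non-degenerate if and only if the entries of `Λ_n` in this block are distinct. -/
theorem SchemeRun.nonDegenerate_block_iff (S : SchemeRun A a n) (i : Fin m)
    [Fintype {j : Fin m // SameBlock S.lam n i j}]
    [DecidableEq {j : Fin m // SameBlock S.lam n i j}] :
    NonDegenerate (Matrix.of fun p q : {j : Fin m // SameBlock S.lam n i j} =>
        tildeLambda a S.lam S.coef n p.1 q.1) ↔
      ∀ p q : {j : Fin m // SameBlock S.lam n i j}, S.lam n p = S.lam n q → p = q := by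
  have hb := S.M_block n le_rfl
  have hM := (Matrix.isUnit_iff_isUnit_det _).mp (S.M_isUnit n le_rfl)
  refine nonDegenerate_iff_injective
    (M := Matrix.of fun p q : {j : Fin m // SameBlock S.lam n i j} => S.M n p.1 q.1)
    (N := Matrix.of fun p q : {j : Fin m // SameBlock S.lam n i j} => (S.M n)⁻¹ p.1 q.1)
    (d := fun p => S.lam n p) ?_ ?_
  · rw [← submatrix_mul_of_isBlockDiagonal i _ hb, Matrix.nonsing_inv_mul _ hM]
    ext p q
    simp [Matrix.one_apply, Subtype.ext_iff]
  · rw [← submatrix_mul_of_isBlockDiagonal i _ hb]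
    have h1 := S.M_diag n le_rfl
    have h2 : tildeLambda a S.lam S.coef n * S.M n = S.M n * Matrix.diagonal (S.lam n) := by
      rw [← h1, mul_assoc, Matrix.mul_nonsing_inv_cancel_left _ _ hM]
    rw [h2]
    ext p q
    simp only [Matrix.of_apply, Matrix.mul_diagonal]

/-- Forgetting the levels above `k`. -/
def SchemeRun.restrict (S : SchemeRun A a n) {k : ℕ} (hk : k ≤ n) : SchemeRun A a k where
  fam := S.fam
  coef := S.coef
  lam := S.lam
  K := S.K
  M := S.M
  M_isUnit l hl := S.M_isUnit l (hl.trans hk)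
  M_block l hl := S.M_block l (hl.trans hk)
  M_diag l hl := S.M_diag l (hl.trans hk)
  grouped l hl := S.grouped l (hl.trans hk)
  K_block l hl := S.K_block l (hl.trans_le hk)
  K_sylvester l hl := S.K_sylvester l (hl.trans_le hk)
  fam_zero := S.fam_zero
  fam_succ l hl := S.fam_succ l (hl.trans_le hk)
  fam_expansion l hl := S.fam_expansion l (hl.trans hk)

/-- A family which is non-degenerate of order `n` has a run whose `Λ_0, …, Λ_n` separate all
indices, while `Λ_0, …, Λ_{n - 1}` do not if there is anything to separate. -/
theorem NonDegenerateOfOrder.exists_run (hn : NonDegenerateOfOrder A a n) :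
    ∃ S : SchemeRun A a n, (∀ i j, i ≠ j → ∃ k ≤ n, S.lam k i ≠ S.lam k j) ∧
      (1 ≤ n ∨ 2 ≤ m → ∃ i j, i ≠ j ∧ SameBlock S.lam n i j) := by
  classical
  obtain ⟨⟨S, hS⟩, hmin⟩ := hn
  refine ⟨S, fun i j hij => ?_, fun h => ?_⟩
  · by_contra! hc
    have h1 := (S.nonDegenerate_block_iff i).mp (hS i)
      ⟨i, fun _ _ => rfl⟩ ⟨j, fun k hk => hc k hk.le⟩ (hc n le_rfl)
    exact hij (congrArg Subtype.val h1)
  · rcases Nat.eq_zero_or_pos n with rfl | hpos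
    · have h2 : 2 ≤ m := by omega
      exact ⟨⟨0, by omega⟩, ⟨1, by omega⟩, by simp, fun k hk => absurd hk k.not_lt_zero⟩
    · by_contra! hc
      have h1 : HasNonDegenerateBlocks A a (n - 1) := by
        refine ⟨S.restrict (Nat.sub_le n 1), fun i => ?_⟩
        refine ((S.restrict (Nat.sub_le n 1)).nonDegenerate_block_iff i).mpr fun p q hpq => ?_
        by_contra hne
        refine hc p q (fun h => hne (Subtype.ext h)) fun k hk => ?_
        rcases Nat.lt_or_ge k (n - 1) with hk' | hk'
        · exact (p.2.symm.trans q.2) k hk'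
        · obtain rfl : k = n - 1 := by omega
          exact hpq
      have := hmin h1
      omega

end Separation

/-- Borel summation of a formal diagonaliser. -/
theorem exists_asymptotic_diagonaliser {𝕜 : Type*} [RCLike 𝕜] [NormedAlgebra 𝕜 ℂ] {m : ℕ}
    {A : 𝕜 → Mat m} {a : ℕ → Mat m} (ha : HasFullExpansion A a) {Q : (Mat m)⟦X⟧}
    {d : ℕ → Fin m → ℂ} (hQ0 : IsUnit (PowerSeries.coeff 0 Q))
    (hQ : PowerSeries.mk a * Q = Q * PowerSeries.mk (fun k => Matrix.diagonal (d k))) :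
    ∃ (M : 𝕜 → Mat m) (f : 𝕜 → Fin m → ℂ),
      (∃ C : ℝ, ∀ ρ, IsUnit (M ρ) ∧ ‖M ρ‖ ≤ C ∧ ‖(M ρ)⁻¹‖ ≤ C) ∧
      HasFullExpansion M (fun k => PowerSeries.coeff k Q) ∧
      HasFullExpansion (fun ρ => Matrix.diagonal (f ρ)) (fun k => Matrix.diagonal (d k)) ∧
      ∀ N : ℕ, (fun ρ : 𝕜 => A ρ * M ρ - M ρ * Matrix.diagonal (f ρ))
        =O[𝓝 0] (fun ρ : 𝕜 => ρ ^ N) := by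
  classical
  obtain ⟨F, hF⟩ := exists_hasFullExpansion (𝕜 := 𝕜) fun k => PowerSeries.coeff k Q
  obtain ⟨f, hf⟩ := exists_hasFullExpansion_diagonal (𝕜 := 𝕜) d
  set M₀ : Mat m := PowerSeries.coeff 0 Q with hM₀
  let C : ℝ := max (max (‖M₀‖ + 1) (‖M₀⁻¹‖ + 1)) (max ‖(1 : Mat m)‖ ‖(1 : Mat m)⁻¹‖)
  -- Where Borel's lemma does not give a well-conditioned matrix, `M` is replaced by `1`.
  let good : 𝕜 → Prop := fun ρ => IsUnit (F ρ) ∧ ‖F ρ‖ ≤ C ∧ ‖(F ρ)⁻¹‖ ≤ C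
  have hgood : ∀ᶠ ρ in 𝓝 0, good ρ := by
    have h1 : Tendsto (fun ρ => ‖F ρ‖) (𝓝 0) (𝓝 ‖M₀‖) := hF.tendsto.norm
    have h2 : Tendsto (fun ρ => ‖(F ρ)⁻¹‖) (𝓝 0) (𝓝 ‖M₀⁻¹‖) := by
      obtain ⟨u, hu⟩ := hQ0
      have h3 := NormedRing.inverse_continuousAt u
      rw [hu] at h3
      simp only [Matrix.nonsing_inv_eq_ringInverse]
      exact (h3.tendsto.comp hF.tendsto).norm
    filter_upwards [hF.eventually_isUnit hQ0, h1.eventually_lt_const (lt_add_one _),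
      h2.eventually_lt_const (lt_add_one _)] with ρ h4 h5 h6
    exact ⟨h4, h5.le.trans ((le_max_left _ _).trans (le_max_left _ _)),
      h6.le.trans ((le_max_right _ _).trans (le_max_left _ _))⟩
  have hM : HasFullExpansion (fun ρ => if good ρ then F ρ else 1)
      (fun k => PowerSeries.coeff k Q) :=
    hF.congr' (hgood.mono fun ρ hρ => by simp only [hρ, if_true])
  refine ⟨fun ρ => if good ρ then F ρ else 1, f, ⟨C, fun ρ => ?_⟩, hM, hf, ?_⟩
  · by_cases h : good ρ
    · simp only [h, if_true]
      exact h
    · simp only [h, if_false]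
      exact ⟨isUnit_one, (le_max_left _ _).trans (le_max_right _ _),
        (le_max_right _ _).trans (le_max_right _ _)⟩
  · have ha' : HasFullExpansion A fun j => PowerSeries.coeff j (PowerSeries.mk a) := by
      simpa using ha
    have hf' : HasFullExpansion (fun ρ => Matrix.diagonal (f ρ)) fun j =>
        PowerSeries.coeff j (PowerSeries.mk fun k => Matrix.diagonal (d k)) := by
      simpa using hf
    exact ((ha'.mul hM).sub (hM.mul hf')).isBigO_of_eq_zero fun k => by rw [hQ, sub_self]

/-! ### Eigenvalues -/

section Eigenvalues

theorem norm_entry_le {m : ℕ} (B : Mat m) (i j : Fin m) : ‖B i j‖ ≤ ‖B‖ := by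
  rw [Matrix.linfty_opNorm_def]
  have h1 : ‖B i j‖₊ ≤ ∑ l, ‖B i l‖₊ :=
    Finset.single_le_sum (f := fun l => ‖B i l‖₊) (fun _ _ => zero_le) (Finset.mem_univ j)
  have h2 : ∑ l, ‖B i l‖₊ ≤ Finset.univ.sup fun i => ∑ l, ‖B i l‖₊ :=
    Finset.le_sup (f := fun i => ∑ l, ‖B i l‖₊) (Finset.mem_univ i)
  exact_mod_cast h1.trans h2

theorem exists_uniform_bound {ι α E F : Type*} [Fintype ι] [NormedAddCommGroup E]
    [NormedAddCommGroup F] {l : Filter α} {f : ι → α → E} {g : ι → α → F}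
    (h : ∀ i, f i =O[l] g i) : ∃ C > 0, ∀ᶠ x in l, ∀ i, ‖f i x‖ ≤ C * ‖g i x‖ := by
  choose c hc hb using fun i => (h i).exists_pos
  refine ⟨1 + ∑ i, c i, add_pos_of_pos_of_nonneg one_pos (Finset.sum_nonneg fun i _ => (hc i).le),
    eventually_all.mpr fun i => ?_⟩
  filter_upwards [(hb i).bound] with x hx
  refine hx.trans (mul_le_mul_of_nonneg_right ?_ (norm_nonneg _))
  have := Finset.single_le_sum (f := c) (fun i _ => (hc i).le) (Finset.mem_univ i)
  linarith

theorem exists_roots_charpoly_eq {m : ℕ} (B : Mat m) :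
    ∃ z : Fin m → ℂ, B.charpoly.roots = Finset.univ.val.map z := by
  have h1 : Multiset.card B.charpoly.roots = m := by
    rw [(IsAlgClosed.splits B.charpoly).natDegree_eq_card_roots.symm,
      Matrix.charpoly_natDegree_eq_dim, Fintype.card_fin]
  obtain ⟨l, hl⟩ := Quot.exists_rep B.charpoly.roots
  have hl' : (l : Multiset ℂ) = B.charpoly.roots := hl
  have hlen : l.length = m := by rw [← h1, ← hl', Multiset.coe_card]
  subst hlen
  refine ⟨l.get, ?_⟩
  rw [← hl', Fin.univ_val_map, List.ofFn_get]

theorem eval_charpoly_eq_prod {m : ℕ} {B : Mat m} {z : Fin m → ℂ}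
    (hz : B.charpoly.roots = Finset.univ.val.map z) (x : ℂ) :
    B.charpoly.eval x = ∏ i, (x - z i) := by
  have h1 := (IsAlgClosed.splits B.charpoly).eq_prod_roots_of_monic B.charpoly_monic
  rw [h1, hz, Polynomial.eval_multiset_prod, Multiset.map_map, Multiset.map_map]
  simp [Finset.prod]

theorem roots_charpoly_of_mul_eq {m : ℕ} {B M : Mat m} {d : Fin m → ℂ} (hM : IsUnit M)
    (h : B * M = M * Matrix.diagonal d) : B.charpoly.roots = Finset.univ.val.map d := by
  obtain ⟨u, rfl⟩ := hM
  have hu : IsUnit u.val.det := (Matrix.isUnit_iff_isUnit_det _).mp u.isUnit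
  have h1 : B = u.val * Matrix.diagonal d * u.val⁻¹ := by
    rw [← h, mul_assoc, Matrix.mul_nonsing_inv _ hu, mul_one]
  rw [h1, Matrix.charpoly_units_conj, Matrix.charpoly_diagonal]
  have h2 := Polynomial.roots_multiset_prod_X_sub_C (Finset.univ.val.map d)
  rwa [Multiset.map_map] at h2

variable {𝕜 : Type*} [RCLike 𝕜]

theorem det_isBigO_of_column {m N : ℕ} {Y : 𝕜 → Mat m} {i : Fin m}
    (h1 : ∀ p q, (fun ρ => Y ρ p q) =O[𝓝 0] fun _ => (1 : 𝕜))
    (hi : ∀ p, (fun ρ => Y ρ p i) =O[𝓝 0] fun ρ : 𝕜 => ρ ^ N) :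
    (fun ρ => (Y ρ).det) =O[𝓝 0] fun ρ : 𝕜 => ρ ^ N := by
  simp only [Matrix.det_apply']
  refine IsBigO.fun_sum fun σ _ => ?_
  refine IsBigO.const_mul_left ?_ _
  have h2 := IsBigO.finsetProd (l := 𝓝 (0 : 𝕜)) (s := Finset.univ)
    (f := fun l ρ => Y ρ (σ l) l) (g := fun l (ρ : 𝕜) => if l = i then ρ ^ N else 1)
    (fun l _ => by
      by_cases hl : l = i
      · subst hl
        simpa using hi (σ l)
      · simpa [hl] using h1 (σ l) l)
  simpa using h2

/-- If `A M - M diagonal f` is small, each `f i` is almost a zero of the characteristic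
polynomial of `A`: column `i` of `f i - M⁻¹ A M` is small. -/
theorem eval_charpoly_isBigO {m N : ℕ} {A M : 𝕜 → Mat m} {f : 𝕜 → Fin m → ℂ} {C : ℝ}
    (hM : ∀ ρ, IsUnit (M ρ) ∧ ‖M ρ‖ ≤ C ∧ ‖(M ρ)⁻¹‖ ≤ C)
    (hf : (fun ρ => Matrix.diagonal (f ρ)) =O[𝓝 0] fun _ => (1 : 𝕜))
    (h : (fun ρ => A ρ * M ρ - M ρ * Matrix.diagonal (f ρ)) =O[𝓝 0] fun ρ : 𝕜 => ρ ^ N)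
    (i : Fin m) :
    (fun ρ => (A ρ).charpoly.eval (f ρ i)) =O[𝓝 0] fun ρ : 𝕜 => ρ ^ N := by
  let R : 𝕜 → Mat m := fun ρ => (M ρ)⁻¹ * (A ρ * M ρ - M ρ * Matrix.diagonal (f ρ))
  have hR : R =O[𝓝 0] fun ρ : 𝕜 => ρ ^ N := by
    have h1 : (fun ρ => (M ρ)⁻¹) =O[𝓝 0] fun _ => (1 : 𝕜) :=
      IsBigO.of_bound C (Eventually.of_forall fun ρ => by simpa using (hM ρ).2.2)
    simpa using h1.mul h
  have hdet : ∀ ρ, (A ρ).charpoly.eval (f ρ i) =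
      (Matrix.scalar (Fin m) (f ρ i) - (Matrix.diagonal (f ρ) + R ρ)).det := by
    intro ρ
    obtain ⟨u, hu⟩ := (hM ρ).1
    have hu' : IsUnit u.val.det := (Matrix.isUnit_iff_isUnit_det _).mp u.isUnit
    have h2 : Matrix.diagonal (f ρ) + R ρ = u.val⁻¹ * A ρ * u.val := by
      simp only [R, ← hu, mul_sub, ← mul_assoc, Matrix.nonsing_inv_mul _ hu', one_mul]
      abel
    rw [h2, ← Matrix.eval_charpoly, Matrix.charpoly_units_conj']
  have hR' : ∀ p q, (fun ρ => R ρ p q) =O[𝓝 0] fun ρ : 𝕜 => ρ ^ N := fun p q =>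
    (IsBigO.of_norm_le fun ρ => norm_entry_le (R ρ) p q).trans hR.norm_left
  have hf' : ∀ p, (fun ρ => f ρ p) =O[𝓝 0] fun _ => (1 : 𝕜) := fun p =>
    (IsBigO.of_norm_le (g := fun ρ => ‖Matrix.diagonal (f ρ)‖) fun ρ => by
      simpa only [Matrix.diagonal_apply_eq] using
        norm_entry_le (Matrix.diagonal (f ρ)) p p).trans hf.norm_left
  have hN : (fun ρ : 𝕜 => ρ ^ N) =O[𝓝 0] fun _ => (1 : 𝕜) := by
    simpa using isBigO_pow_of_le (𝕜 := 𝕜) N.zero_le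
  simp only [hdet]
  refine det_isBigO_of_column (i := i) (fun p q => ?_) fun p => ?_
  · have h3 := ((hR' p q).trans hN).neg_left
    rcases eq_or_ne p q with rfl | hpq
    · refine (((hf' i).sub (hf' p)).add h3).congr_left fun ρ => ?_
      simp
      ring
    · simpa [hpq] using h3
  · refine (hR' p i).neg_left.congr_left fun ρ => ?_
    rcases eq_or_ne p i with rfl | hpi
    · simp
    · simp [hpi]

/-- A point where a product `∏ (x - z j)` is small is close to one of the `z j`. -/
theorem exists_norm_sub_le_of_prod_le {m : ℕ} (hm : 0 < m) {x : ℂ} {z : Fin m → ℂ} {C r : ℝ}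
    (hC : 0 < C) (hr : 0 ≤ r) (h : ‖∏ j, (x - z j)‖ ≤ C * r ^ m) :
    ∃ j, ‖x - z j‖ ≤ (C + 1) * r := by
  have : Nonempty (Fin m) := ⟨⟨0, hm⟩⟩
  obtain ⟨j, -, hj⟩ := Finset.exists_min_image Finset.univ (fun j => ‖x - z j‖)
    Finset.univ_nonempty
  refine ⟨j, ?_⟩
  have h1 : ‖x - z j‖ ^ m ≤ ‖∏ j, (x - z j)‖ := by
    rw [norm_prod]
    calc ‖x - z j‖ ^ m = ∏ _l : Fin m, ‖x - z j‖ := by simp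
      _ ≤ _ := Finset.prod_le_prod (fun _ _ => norm_nonneg _) hj
  have h2 : C * r ^ m ≤ ((C + 1) * r) ^ m := by
    rw [mul_pow]
    refine mul_le_mul_of_nonneg_right ?_ (by positivity)
    calc C ≤ C + 1 := by linarith
      _ ≤ (C + 1) ^ m := le_self_pow₀ (by linarith) hm.ne'
  exact le_of_pow_le_pow_left₀ hm.ne' (by positivity) ((h1.trans h).trans h2)

/-- Localisation and continuity of eigenvalues. Suppose that the `μ i` are continuous with mutual
distances bounded below by a multiple of `‖ρ‖ ^ n`, and are approximated to order `n + 1` by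
functions at which the characteristic polynomial of `A` is `O(ρ ^ (m (n + 1)))`. Then each of the
`m` disjoint discs of radius `C ‖ρ‖ ^ (n + 1)` around the `μ i ρ` contains an eigenvalue, hence
exactly one, and the eigenvalues found in this way are continuous. -/
theorem exists_eigenvalues_near {m n : ℕ} (hm : 0 < m) {A : 𝕜 → Mat m} (hA : Continuous A)
    {μ : Fin m → 𝕜 → ℂ} (hμ : ∀ i, Continuous (μ i))
    (hsep : ∀ i j, i ≠ j → (fun ρ : 𝕜 => ρ ^ n) =O[𝓝 0] fun ρ => μ i ρ - μ j ρ)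
    {g : 𝕜 → Fin m → ℂ}
    (hg : ∀ i, (fun ρ => (A ρ).charpoly.eval (g ρ i)) =O[𝓝 0] fun ρ : 𝕜 => ρ ^ (m * (n + 1)))
    (hgμ : ∀ i, (fun ρ => μ i ρ - g ρ i) =O[𝓝 0] fun ρ : 𝕜 => ρ ^ (n + 1))
    (h0 : (A 0).charpoly.roots = Finset.univ.val.map fun i => μ i 0) :
    ∃ ev : Fin m → 𝕜 → ℂ,
      (∀ ρ, (A ρ).charpoly.roots = Finset.univ.val.map fun i => ev i ρ) ∧
      (∃ U ∈ 𝓝 (0 : 𝕜), ∀ i, ContinuousOn (ev i) U) ∧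
      ∀ i, (fun ρ => μ i ρ - ev i ρ) =O[𝓝 0] fun ρ : 𝕜 => ρ ^ (n + 1) := by
  classical
  choose z hz using fun ρ => exists_roots_charpoly_eq (A ρ)
  obtain ⟨C₁, hC₁, h1⟩ := exists_uniform_bound hg
  obtain ⟨C₂, hC₂, h2⟩ := exists_uniform_bound hgμ
  obtain ⟨C₃, hC₃, h3⟩ := exists_uniform_bound
    (f := fun (_ : {p : Fin m × Fin m // p.1 ≠ p.2}) (ρ : 𝕜) => ρ ^ n)
    (g := fun p ρ => μ p.1.1 ρ - μ p.1.2 ρ) fun p => hsep p.1.1 p.1.2 p.2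
  set C : ℝ := C₂ + (C₁ + 1) with hCdef
  have hC : 0 < C := by positivity
  -- The radius below which the discs, of radius `C ‖ρ‖ ^ (n + 1)`, are far from each other.
  have h4 : ∀ᶠ ρ : 𝕜 in 𝓝 0, ‖ρ‖ < (4 * C * C₃)⁻¹ := by
    filter_upwards [Metric.ball_mem_nhds (0 : 𝕜)
      (show 0 < (4 * C * C₃)⁻¹ by positivity)] with ρ hρ
    simpa using hρ
  have hU : ∀ᶠ ρ : 𝕜 in 𝓝 0, (∀ i, ∃ j, ‖μ i ρ - z ρ j‖ ≤ C * ‖ρ‖ ^ (n + 1)) ∧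
      ∀ i j, i ≠ j → 4 * (C * ‖ρ‖ ^ (n + 1)) ≤ ‖μ i ρ - μ j ρ‖ := by
    filter_upwards [h1, h2, h3, h4] with ρ h1 h2 h3 h4
    refine ⟨fun i => ?_, fun i j hij => ?_⟩
    · have h5 := h1 i
      rw [eval_charpoly_eq_prod (hz ρ), norm_pow, mul_comm m, pow_mul] at h5
      obtain ⟨j, hj⟩ := exists_norm_sub_le_of_prod_le hm hC₁ (by positivity) h5
      refine ⟨j, ?_⟩
      have h6 := h2 i
      rw [norm_pow] at h6
      calc ‖μ i ρ - z ρ j‖ ≤ ‖μ i ρ - g ρ i‖ + ‖g ρ i - z ρ j‖ :=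
            norm_sub_le_norm_sub_add_norm_sub _ _ _
        _ ≤ C * ‖ρ‖ ^ (n + 1) := by rw [hCdef, add_mul]; exact add_le_add h6 hj
    · have h5 := h3 ⟨(i, j), hij⟩
      simp only [norm_pow] at h5
      have h6 : 4 * C * C₃ * ‖ρ‖ ≤ 1 := by
        calc 4 * C * C₃ * ‖ρ‖ ≤ 4 * C * C₃ * (4 * C * C₃)⁻¹ :=
              mul_le_mul_of_nonneg_left h4.le (by positivity)
          _ = 1 := mul_inv_cancel₀ (by positivity)
      calc 4 * (C * ‖ρ‖ ^ (n + 1)) = 4 * C * ‖ρ‖ * ‖ρ‖ ^ n := by ring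
        _ ≤ 4 * C * ‖ρ‖ * (C₃ * ‖μ i ρ - μ j ρ‖) := mul_le_mul_of_nonneg_left h5 (by positivity)
        _ = 4 * C * C₃ * ‖ρ‖ * ‖μ i ρ - μ j ρ‖ := by ring
        _ ≤ ‖μ i ρ - μ j ρ‖ := mul_le_of_le_one_left (norm_nonneg _) h6
  obtain ⟨U, hUsub, hUo, h0U⟩ := eventually_nhds_iff.mp hU
  have hchoice : ∀ ρ, ∃ e : Fin m → ℂ, (A ρ).charpoly.roots = Finset.univ.val.map e ∧
      (ρ ∈ U → ∀ i, ‖μ i ρ - e i‖ ≤ C * ‖ρ‖ ^ (n + 1)) := by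
    intro ρ
    by_cases hρU : ρ ∈ U
    · by_cases hρ : ρ = 0
      · exact ⟨fun i => μ i ρ, by rw [hρ, h0], fun _ i => by rw [sub_self, norm_zero]; positivity⟩
      · obtain ⟨hnear, hfar⟩ := hUsub ρ hρU
        choose σ hσ using hnear
        have hr : 0 < C * ‖ρ‖ ^ (n + 1) := mul_pos hC (pow_pos (norm_pos_iff.mpr hρ) _)
        have hinj : Function.Injective σ := by
          intro i j hij
          by_contra hne
          have h5 := hfar i j hne
          have h6 := norm_sub_le_norm_sub_add_norm_sub (μ i ρ) (z ρ (σ i)) (μ j ρ)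
          have h7 := hσ i
          have h8 := hσ j
          rw [← hij, norm_sub_rev] at h8
          linarith
        let e : Fin m ≃ Fin m := Equiv.ofBijective σ (Finite.injective_iff_bijective.mp hinj)
        refine ⟨fun i => z ρ (σ i), ?_, fun _ => hσ⟩
        have h9 : Multiset.map σ Finset.univ.val = Finset.univ.val := by
          have := congrArg Finset.val (Finset.univ_map_equiv_to_embedding e)
          rwa [Finset.map_val] at this
        rw [hz ρ]
        conv_lhs => rw [← h9]
        rw [Multiset.map_map]
        rfl
    · exact ⟨z ρ, hz ρ, fun h => absurd h hρU⟩
  choose e he hnear using hchoice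
  have hmem : U ∈ 𝓝 (0 : 𝕜) := hUo.mem_nhds h0U
  refine ⟨fun i ρ => e ρ i, he, ⟨U, hmem, fun i ρ₀ hρ₀ => ?_⟩, fun i => ?_⟩
  · refine ContinuousAt.continuousWithinAt ?_
    have hUρ : ∀ᶠ ρ in 𝓝 ρ₀, ρ ∈ U := hUo.mem_nhds hρ₀
    have hrad : Continuous fun ρ : 𝕜 => C * ‖ρ‖ ^ (n + 1) := by fun_prop
    rw [ContinuousAt, tendsto_iff_norm_sub_tendsto_zero]
    by_cases hz0 : ρ₀ = 0
    · subst hz0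
      have h5 : Tendsto (fun ρ => ‖μ i ρ - μ i 0‖ + 2 * (C * ‖ρ‖ ^ (n + 1))) (𝓝 0) (𝓝 0) := by
        have : Continuous fun ρ : 𝕜 => ‖μ i ρ - μ i 0‖ + 2 * (C * ‖ρ‖ ^ (n + 1)) := by
          have := hμ i
          fun_prop
        simpa using this.tendsto 0
      refine squeeze_zero' (Eventually.of_forall fun _ => norm_nonneg _) ?_ h5
      filter_upwards [hUρ] with ρ hρ
      have h6 := hnear ρ hρ i
      have h7 := hnear 0 hρ₀ i
      rw [norm_zero, zero_pow n.succ_ne_zero, mul_zero] at h7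
      have h8 : e ρ i - e 0 i = (μ i ρ - μ i 0) - (μ i ρ - e ρ i) + (μ i 0 - e 0 i) := by ring
      have h9 := norm_add_le ((μ i ρ - μ i 0) - (μ i ρ - e ρ i)) (μ i 0 - e 0 i)
      have h10 := norm_sub_le (μ i ρ - μ i 0) (μ i ρ - e ρ i)
      have h11 : 0 ≤ C * ‖ρ‖ ^ (n + 1) := by positivity
      rw [h8]
      linarith
    · -- The other eigenvalues stay away from `x`, so the characteristic polynomial controls
      -- the distance from `x` to the `i`-th eigenvalue.
      set x := e ρ₀ i with hx
      set η := C * ‖ρ₀‖ ^ (n + 1) with hη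
      have hηpos : 0 < η := mul_pos hC (pow_pos (norm_pos_iff.mpr hz0) _)
      have hP : Tendsto (fun ρ => ‖(A ρ).charpoly.eval x‖ / η ^ (m - 1)) (𝓝 ρ₀) (𝓝 0) := by
        have h5 : Continuous fun ρ => (A ρ).charpoly.eval x := by
          simp only [Matrix.eval_charpoly]
          exact (continuous_const.sub hA).matrix_det
        have h6 := (h5.norm.div_const (η ^ (m - 1))).tendsto ρ₀
        have h7 : (A ρ₀).charpoly.eval x = 0 := by
          rw [eval_charpoly_eq_prod (he ρ₀)]
          exact Finset.prod_eq_zero (Finset.mem_univ i) (by rw [hx, sub_self])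
        simpa [h7] using h6
      have haway : ∀ j, j ≠ i → ∀ᶠ ρ in 𝓝 ρ₀, η ≤ ‖x - e ρ j‖ := by
        intro j hj
        have h5 : Tendsto (fun ρ => ‖μ i ρ₀ - μ j ρ‖ - η - C * ‖ρ‖ ^ (n + 1)) (𝓝 ρ₀)
            (𝓝 (‖μ i ρ₀ - μ j ρ₀‖ - η - C * ‖ρ₀‖ ^ (n + 1))) := by
          have : Continuous fun ρ : 𝕜 => ‖μ i ρ₀ - μ j ρ‖ - η - C * ‖ρ‖ ^ (n + 1) := by
            have := hμ j
            fun_prop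
          exact this.tendsto ρ₀
        have h6 := (hUsub ρ₀ hρ₀).2 i j hj.symm
        filter_upwards [hUρ, h5.eventually_const_lt (u := η) (by linarith)] with ρ hρ h7
        have h8 := hnear ρ hρ j
        have h9 := hnear ρ₀ hρ₀ i
        have h10 : μ i ρ₀ - μ j ρ = (μ i ρ₀ - x) + (x - e ρ j) - (μ j ρ - e ρ j) := by ring
        have h11 := norm_sub_le ((μ i ρ₀ - x) + (x - e ρ j)) (μ j ρ - e ρ j)
        have h12 := norm_add_le (μ i ρ₀ - x) (x - e ρ j)
        rw [← h10] at h11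
        linarith
      have haway' : ∀ᶠ ρ in 𝓝 ρ₀, ∀ j ∈ Finset.univ.erase i, η ≤ ‖x - e ρ j‖ :=
        (eventually_all_finset _).mpr fun j hj => haway j (Finset.ne_of_mem_erase hj)
      refine squeeze_zero' (Eventually.of_forall fun _ => norm_nonneg _) ?_ hP
      filter_upwards [haway'] with ρ hρ
      rw [le_div_iff₀ (pow_pos hηpos _), eval_charpoly_eq_prod (he ρ), norm_prod,
        ← Finset.mul_prod_erase _ _ (Finset.mem_univ i), norm_sub_rev]
      refine mul_le_mul_of_nonneg_left ?_ (norm_nonneg _)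
      calc η ^ (m - 1) = ∏ _j ∈ Finset.univ.erase i, η := by
            rw [Finset.prod_const, Finset.card_erase_of_mem (Finset.mem_univ i),
              Finset.card_univ, Fintype.card_fin]
        _ ≤ _ := Finset.prod_le_prod (fun _ _ => hηpos.le) hρ
  · refine IsBigO.of_bound C ?_
    filter_upwards [hmem] with ρ hρ
    rw [norm_pow]
    exact hnear ρ hρ i

/-- The difference of two polynomials of degree at most `n` which do not have the same
coefficients is bounded below by a multiple of `‖ρ‖ ^ n`. -/
theorem pow_isBigO_sum_sub_sum [NormedAlgebra 𝕜 ℂ] {n : ℕ} {b c : ℕ → ℂ}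
    (h : ∃ k ≤ n, b k ≠ c k) :
    (fun ρ : 𝕜 => ρ ^ n) =O[𝓝 0] fun ρ : 𝕜 =>
      ∑ k ∈ Finset.range (n + 1), ρ ^ k • b k - ∑ k ∈ Finset.range (n + 1), ρ ^ k • c k := by
  classical
  have h' : ∃ k, b k ≠ c k := h.imp fun k hk => hk.2
  set s := Nat.find h' with hs
  have hne : b s ≠ c s := Nat.find_spec h'
  have hlt : ∀ k < s, b k = c k := fun k hk => not_not.mp (Nat.find_min h' hk)
  have hsn : s ≤ n := by
    obtain ⟨k, hk, hbc⟩ := h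
    exact (Nat.find_min' h' hbc).trans hk
  obtain ⟨d, rfl⟩ := Nat.exists_eq_add_of_le hsn
  -- The difference is `ρ ^ s • q ρ`, where `q` does not vanish at `0`.
  let q : 𝕜 → ℂ := fun ρ => ∑ k ∈ Finset.range (d + 1), ρ ^ k • (b (s + k) - c (s + k))
  have hq : ∀ ρ : 𝕜, ∑ k ∈ Finset.range (s + d + 1), ρ ^ k • b k -
      ∑ k ∈ Finset.range (s + d + 1), ρ ^ k • c k = ρ ^ s • q ρ := by
    intro ρ
    rw [← Finset.sum_sub_distrib, add_assoc, Finset.sum_range_add,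
      Finset.sum_eq_zero fun k hk => by rw [hlt k (Finset.mem_range.mp hk), sub_self], zero_add,
      Finset.smul_sum]
    simp only [smul_smul, ← pow_add, smul_sub]
  have hq0 : Tendsto q (𝓝 0) (𝓝 (b s - c s)) := by
    have h1 : Continuous q := by fun_prop
    have h2 : q 0 = b s - c s := by simp [q, Finset.sum_range_succ']
    simpa [h2] using h1.tendsto 0
  have hpos : 0 < ‖b s - c s‖ := norm_pos_iff.mpr (sub_ne_zero.mpr hne)
  refine (isBigO_pow_of_le (Nat.le_add_right s d)).trans
    (IsBigO.of_bound (‖b s - c s‖ / 2)⁻¹ ?_)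
  filter_upwards [hq0.norm.eventually_const_lt (half_lt_self hpos)] with ρ hρ
  rw [hq, norm_smul, mul_left_comm]
  refine le_mul_of_one_le_right (norm_nonneg _) ?_
  rw [← div_eq_inv_mul, one_le_div (by positivity)]
  exact hρ.le

end Eigenvalues

end MultiStep

theorem mainTheorem2 {𝕜 : Type*} [RCLike 𝕜] [NormedAlgebra 𝕜 ℂ] {m : ℕ}
    (A : 𝕜 → MultiStep.Mat m) (hA : Continuous A)
    (a : ℕ → MultiStep.Mat m) (ha : MultiStep.HasFullExpansion A a)
    (n : ℕ) (hn : MultiStep.NonDegenerateOfOrder A a n) :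
    (∃ M Λ : 𝕜 → MultiStep.Mat m,
      (∃ C : ℝ, ∀ ρ, IsUnit (M ρ) ∧ ‖M ρ‖ ≤ C ∧ ‖(M ρ)⁻¹‖ ≤ C) ∧
      (∃ b : ℕ → MultiStep.Mat m, MultiStep.HasFullExpansion M b) ∧
      (∀ ρ, (Λ ρ).IsDiag) ∧
      (∀ N : ℕ, (fun ρ : 𝕜 => A ρ * M ρ - M ρ * Λ ρ) =O[𝓝 0] (fun ρ : 𝕜 => ρ ^ N))) ∧
    (1 ≤ n ∨ 2 ≤ m →
      ∃ ev : Fin m → 𝕜 → ℂ,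
        (∀ ρ, (A ρ).charpoly.roots = Finset.univ.val.map (fun i => ev i ρ)) ∧
        (∃ U ∈ 𝓝 (0 : 𝕜), ∀ i, ContinuousOn (ev i) U) ∧
        ∃ i j, i ≠ j ∧
          (fun ρ : 𝕜 => ev i ρ - ev j ρ) =O[𝓝 0] (fun ρ : 𝕜 => ρ ^ n)) := by
  obtain ⟨S, hsep, hsame⟩ := hn.exists_run
  obtain ⟨Q, d, hQ0, hQ, hd⟩ := S.exists_formal_diagonaliser ha hsep
  obtain ⟨M, f, ⟨C, hC⟩, hM, hf, hAM⟩ := MultiStep.exists_asymptotic_diagonaliser ha hQ0 hQ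
  refine ⟨⟨M, fun ρ => Matrix.diagonal (f ρ), ⟨C, hC⟩, ⟨_, hM⟩,
    fun ρ => Matrix.isDiag_diagonal _, hAM⟩, fun hnm => ?_⟩
  obtain ⟨i, j, hij, hblock⟩ := hsame hnm
  -- The eigenvalues up to an error of order `n + 1`.
  let μ : Fin m → 𝕜 → ℂ := fun i ρ => ∑ k ∈ Finset.range (n + 1), ρ ^ k • S.lam k i
  have hμc : ∀ i, Continuous (μ i) := fun i => by fun_prop
  have hμf : ∀ i, (fun ρ => μ i ρ - f ρ i) =O[𝓝 0] fun ρ : 𝕜 => ρ ^ (n + 1) := fun i => by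
    refine (IsBigO.of_norm_le fun ρ => ?_).trans (hf n).norm_left
    have h1 := MultiStep.norm_entry_le
      (Matrix.diagonal (f ρ) - ∑ k ∈ Finset.range (n + 1), ρ ^ k • Matrix.diagonal (d k)) i i
    refine le_trans (le_of_eq ?_) h1
    rw [norm_sub_rev]
    congr 1
    simp only [μ, Matrix.sub_apply, Matrix.diagonal_apply_eq, Matrix.sum_apply, Matrix.smul_apply]
    congr 1
    refine Finset.sum_congr rfl fun k hk => ?_
    rw [hd k (Nat.lt_succ_iff.mp (Finset.mem_range.mp hk))]
  have hdiag0 : A 0 * M 0 = M 0 * Matrix.diagonal fun i => μ i 0 := by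
    have h1 := (hAM 1).eq_zero_imp.self_of_nhds (by simp)
    have h2 : (fun i => μ i 0) = f 0 := funext fun i =>
      sub_eq_zero.mp ((hμf i).eq_zero_imp.self_of_nhds (by simp))
    rw [h2]
    exact sub_eq_zero.mp h1
  obtain ⟨ev, hroots, hcont, hnear⟩ := MultiStep.exists_eigenvalues_near (n := n)
    (Nat.pos_of_ne_zero fun h => by subst h; exact i.elim0) hA hμc
    (fun i j hij => MultiStep.pow_isBigO_sum_sub_sum (hsep i j hij))
    (fun i => MultiStep.eval_charpoly_isBigO hC hf.isBigO_one (hAM _) i) hμf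
    (MultiStep.roots_charpoly_of_mul_eq (hC 0).1 hdiag0)
  refine ⟨ev, hroots, hcont, i, j, hij, ?_⟩
  have hμij : (fun ρ => μ i ρ - μ j ρ) =O[𝓝 0] fun ρ : 𝕜 => ρ ^ n := by
    refine (MultiStep.isBigO_pow_smul n (S.lam n i - S.lam n j)).congr_left fun ρ => ?_
    simp only [μ, Finset.sum_range_succ]
    rw [Finset.sum_congr rfl fun k hk => by rw [hblock k (Finset.mem_range.mp hk)], smul_sub]
    abel
  have h1 := (hμij.sub ((hnear i).trans (MultiStep.isBigO_pow_of_le n.le_succ))).add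
    ((hnear j).trans (MultiStep.isBigO_pow_of_le n.le_succ))
  refine h1.congr_left fun ρ => ?_
  ring
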